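/- All graphs are simple. For a graph $G$, a bond percolation model on $G$ is a probability measure $\mu$ on the configurations (spanning subgraphs) of $G$, i.e. on $\{\text{open},\text{closed}\}^{E(G)}$ with the product $\sigma$-algebra. It is $1$-independent if, for any two edge sets $F_1,F_2\subseteq E(G)$ such that no edge of $F_1$ shares a vertex with an edge of $F_2$, the states of the edges in $F_1$ are independent of the states of the edges in $F_2$. Let $\mathcal{M}_{1,\geqslant p}(G)$ be the set of $1$-independent bond percolation models $\mu$ on $G$ with $\inf_{e\in E(G)}\mu(e\text{ is open})\geqslant p$. The long paths critical probability of an infinite, locally finite, connected graph $G$ is $$p_{1,\ell p}(G):=\inf\bigl\{p\in[0,1]:\ \forall \mu\in\mathcal{M}_{1,\geqslant p}(G),\ \forall n\in\mathbb{N},\ \mu(\exists\text{ open path of length } n)>0\bigr\}.$$ Let $\mathbb{Z}$ also denote the integer line lattice (integers joined when they differ by $1$), let $P_n$, $C_n$, $K_n$ be the path, the cycle and the complete graph on $n$ vertices, and let $\times$ denote the Cartesian product of graphs. **Theorem.** (i) For all $n\geqslant 3$, $\;4-2\sqrt3\leqslant p_{1,\ell p}(\mathbb{Z}\times C_n)\leqslant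 p_{1,\ell p}(\mathbb{Z}\times P_n)\leqslant \frac23$, where $4-2\sqrt3=0.535898\ldots$; (ii) $p_{1,\ell p}(\mathbb{Z}\times K_3)\leqslant \frac1{16}\Bigl(13-\frac{55}{\sqrt[3]{128\sqrt{14}-251}}+\sqrt[3]{128\sqrt{14}-251}\Bigr)=0.63154\ldots$; (iii) $p_{1,\ell p}(\mathbb{Z}\times C_4)\leqslant \frac{3-\sqrt3}{2}=0.63397\ldots$; (iv) $p_{1,\ell p}(\mathbb{Z}\times C_5)\leqslant r$, where $r=0.63895\ldots$ is the unique solution in $[\sqrt3/3,1]$ of the equation $\Bigl(\frac{x(3x^2-1)}{3x-1}\Bigr)^2=4(1-x)^5$; (v) the limit $\lim_{n\to\infty}p_{1,\ell p}(\mathbb{Z}\times K_n)$ exists and $4-2\sqrt3\leqslant \lim_{n\to\infty}p_{1,\ell p}(\mathbb{Z}\times K_n)\leqslant \frac59$. -/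

import Mathlib

open MeasureTheory ProbabilityTheory

namespace OneIndep

/-- A configuration on the host graph `G`: every edge of `G` is open (`true`) or closed (`false`).
The type carries the product σ-algebra. -/
abbrev Configuration {V : Type*} (G : SimpleGraph V) : Type _ := G.edgeSet → Bool

/-- The spanning subgraph of `G` formed by the open edges of a configuration. -/
def openSubgraph {V : Type*} (G : SimpleGraph V) (ω : Configuration G) : SimpleGraph V :=
  SimpleGraph.fromEdgeSet {e : Sym2 V | ∃ h : e ∈ G.edgeSet, ω ⟨e, h⟩ = true}

/-- Two edge sets are `k`-distant if they are disjoint and every path of `G` from (an endpoint of)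
an edge in `F₁` to (an endpoint of) an edge in `F₂` has at least `k` edges.  For `k = 1` this means
that no edge of `F₁` shares a vertex with an edge of `F₂`. -/
def KDistant {V : Type*} (G : SimpleGraph V) (k : ℕ) (F₁ F₂ : Set G.edgeSet) : Prop :=
  Disjoint F₁ F₂ ∧
    ∀ e ∈ F₁, ∀ f ∈ F₂, ∀ u ∈ (e : Sym2 V), ∀ v ∈ (f : Sym2 V), (k : ℕ∞) ≤ G.edist u v

/-- A bond percolation model `μ` on `G` is `k`-independent if the states of the edges in `F₁` are
independent of the states of the edges in `F₂`, for all `k`-distant `F₁`, `F₂`. -/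
def KIndependent {V : Type*} (G : SimpleGraph V) (k : ℕ) (μ : Measure (Configuration G)) : Prop :=
  ∀ F₁ F₂ : Set G.edgeSet, KDistant G k F₁ F₂ →
    IndepFun (fun (ω : Configuration G) (e : F₁) => ω e)
      (fun (ω : Configuration G) (e : F₂) => ω e) μ

/-- The (lower) edge-probability `d(μ)`, the infimum over the edges `e` of `μ(e is open)`. -/
noncomputable def edgeProb {V : Type*} (G : SimpleGraph V) (μ : Measure (Configuration G)) :
    ENNReal :=
  ⨅ e : G.edgeSet, μ {ω | ω e = true}

/-- The class of `k`-independent bond percolation models on `G` with edge-probability at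
least `p`. -/
def modelsGE {V : Type*} (k : ℕ) (p : ℝ) (G : SimpleGraph V) : Set (Measure (Configuration G)) :=
  {μ | IsProbabilityMeasure μ ∧ KIndependent G k μ ∧ ENNReal.ofReal p ≤ edgeProb G μ}

/-- The event that there is an open path with `n` edges. -/
def openPathEvent {V : Type*} (G : SimpleGraph V) (n : ℕ) : Set (Configuration G) :=
  {ω | ∃ (u v : V) (w : (openSubgraph G ω).Walk u v), w.IsPath ∧ w.length = n}

/-- The long paths critical probability for `1`-independent percolation on `G`. -/
noncomputable def longPathsCritProb {V : Type*} (G : SimpleGraph V) : ℝ :=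
  sInf {p : ℝ | p ∈ Set.Icc (0 : ℝ) 1 ∧
    ∀ μ ∈ modelsGE 1 p G, ∀ n : ℕ, 0 < μ (openPathEvent G n)}

/-- The integer line lattice: two integers are adjacent if they differ by `1`. -/
def intLine : SimpleGraph ℤ :=
  SimpleGraph.fromRel fun a b => b = a + 1

/-- The Cartesian product of the integer line lattice with `G`. -/
def lineProd {V : Type*} (G : SimpleGraph V) : SimpleGraph (ℤ × V) :=
  intLine.boxProd G

end OneIndep

/-! Upper bounds. Events living on disjoint blocks of levels are independent. Let `x k` be the
probability that the first `k` levels are connected and consecutive ones are joined by an open rung.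
Adding a connected level costs a factor `f`. The loss when no rung to it is open is at most `g * x
k`, because this failure involves only the last two levels and is independent of the earlier ones.
Hence `x (k + 2) ≥ f * x (k + 1) - g * x k`, with `g = (1 - p) ^ |V|` since rungs are
vertex-disjoint, and `x` stays positive if `4 * g ≤ f ^ 2` (`pos_of_two_step_recursion`,
`mem_longPathProbs_lineProd`). It remains to bound from below the probability that one level is
connected: `p` for a single edge, a count of closed edges for the cycles of length 3 and 4, and a
weighted count for the five-cycle. Restricting models to subgraphs (`longPathProbs_subset`) gives
the comparison of paths with cycles and the monotonicity in `n`.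

Large complete graphs. Above edge density `5/9 = (2/3)² + (1/3)²` a graph has a component with more
than `2/3` of its vertices. Let `B` be this component on level `k + 1`. Level `k` is independent of
`B`, so with high probability some component of level `k` contains more than `2/3 * 2/3 = 4/9` of
all vertices, all of them in `B`. That set meets the large component of level `k`, since `4/9 + 2/3
> 1`, and the at least `5/9` of the vertices with an open rung. So consecutive large components are
joined except with probability at most `1/4`, and the recursion applies with `f = 1`, `g = 1/4`.

Lower bound. A model built from independent vertex states, of period three in the level, confines
every open cluster to five consecutive levels and has edge-probability at least `4 - 2 * √3`. -/

namespace OneIndep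

/-! ### 1-independence, finite dependence, and restriction to subgraphs -/

section Basics

variable {V W : Type*} {G : SimpleGraph V}

lemma openSubgraph_adj {ω : Configuration G} {u v : V} :
    (openSubgraph G ω).Adj u v ↔ ∃ h : G.Adj u v, ω ⟨s(u, v), h⟩ = true := by
  simp only [openSubgraph, SimpleGraph.fromEdgeSet_adj, Set.mem_ofPred_eq]
  constructor
  · rintro ⟨⟨h, h'⟩, _⟩
    exact ⟨h, h'⟩
  · rintro ⟨h, h'⟩
    exact ⟨⟨h, h'⟩, h.ne⟩

lemma openSubgraph_le (ω : Configuration G) : openSubgraph G ω ≤ G := by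
  intro u v h
  exact (openSubgraph_adj.1 h).1

/-- The edges of `G` with both endpoints in `S`. -/
def inside (G : SimpleGraph V) (S : Set V) : Set G.edgeSet :=
  {e | ∀ v ∈ (e : Sym2 V), v ∈ S}

lemma inside_mono {S T : Set V} (h : S ⊆ T) : inside G S ⊆ inside G T :=
  fun _ he v hv => h (he v hv)

lemma finite_inside {S : Set V} (hS : S.Finite) : (inside G S).Finite := by
  have h1 : (Function.uncurry (fun a b : V => s(a, b)) '' (S ×ˢ S)).Finite :=
    (hS.prod hS).image _
  refine Set.Finite.of_finite_image (f := Subtype.val) (h1.subset ?_)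
    Subtype.val_injective.injOn
  rintro _ ⟨⟨e, he⟩, h, rfl⟩
  induction e using Sym2.ind with
  | _ a b =>
    exact ⟨(a, b), ⟨h a (by simp), h b (by simp)⟩, rfl⟩

lemma kDistant_one_iff {F₁ F₂ : Set G.edgeSet} :
    KDistant G 1 F₁ F₂ ↔ ∀ e ∈ F₁, ∀ f ∈ F₂, ∀ v ∈ (e : Sym2 V), v ∉ (f : Sym2 V) := by
  constructor
  · rintro ⟨-, h⟩ e he f hf v hv hv'
    have := h e he f hf v hv v hv'
    simp at this
  · intro h
    refine ⟨?_, ?_⟩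
    · rw [Set.disjoint_left]
      intro e he he'
      obtain ⟨v, hv⟩ : ∃ v, v ∈ (e : Sym2 V) := ⟨_, Sym2.out_fst_mem _⟩
      exact h e he e he' v hv hv
    · intro e he f hf u hu v hv
      have : u ≠ v := by
        rintro rfl
        exact h e he f hf u hu hv
      rw [Nat.cast_one, Order.one_le_iff_pos, pos_iff_ne_zero]
      exact SimpleGraph.edist_eq_zero_iff.ne.2 this

lemma kDistant_inside {S T : Set V} (h : Disjoint S T) :
    KDistant G 1 (inside G S) (inside G T) :=
  kDistant_one_iff.2 fun _ he _ hf v hv hv' => Set.disjoint_left.1 h (he v hv) (hf v hv')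

lemma adj_congr {S : Set V} {ω ω' : Configuration G} (h : ∀ e ∈ inside G S, ω e = ω' e)
    {u v : V} (hu : u ∈ S) (hv : v ∈ S) :
    (openSubgraph G ω).Adj u v ↔ (openSubgraph G ω').Adj u v := by
  rw [openSubgraph_adj, openSubgraph_adj]
  refine exists_congr fun huv => ?_
  rw [h ⟨s(u, v), huv⟩]
  intro w hw
  rcases Sym2.mem_iff.1 hw with rfl | rfl <;> assumption

section Independence

variable {μ : Measure (Configuration G)} {α β : Type*}

lemma exists_comp_of_dependsOn {S : Set G.edgeSet} [Nonempty α] {f : Configuration G → α}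
    (hf : DependsOn f S) : ∃ g : (S → Bool) → α, ∀ ω, f ω = g (fun e => ω e) := by
  obtain ⟨g, hg⟩ := dependsOn_iff_exists_comp.1 hf
  exact ⟨g, fun ω => by rw [hg]; rfl⟩

lemma measurable_of_dependsOn {S : Set V} (hS : S.Finite) [MeasurableSpace α]
    [Nonempty α] {f : Configuration G → α} (hf : DependsOn f (inside G S)) : Measurable f := by
  obtain ⟨g, hg⟩ := exists_comp_of_dependsOn hf
  have := (finite_inside (G := G) hS).to_subtype
  rw [show f = g ∘ fun ω (e : inside G S) => ω e from funext hg]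
  exact (measurable_of_finite g).comp (measurable_pi_lambda _ fun e => measurable_pi_apply _)

lemma measurableSet_of_dependsOn {S : Set V} (hS : S.Finite) {A : Set (Configuration G)}
    (hA : DependsOn (· ∈ A) (inside G S)) : MeasurableSet A :=
  measurableSet_setOfPred.2 (measurable_of_dependsOn hS hA)

/-- Finiteness of `S` and `T` makes the relevant configuration spaces finite, so that measurability
of `f` and `g` is automatic. -/
lemma KIndependent.indepFun (hμ : KIndependent G 1 μ) {S T : Set V}
    (hS : S.Finite) (hT : T.Finite) (hST : Disjoint S T) [MeasurableSpace α] [MeasurableSpace β]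
    [Nonempty α] [Nonempty β] {f : Configuration G → α} {g : Configuration G → β}
    (hf : DependsOn f (inside G S)) (hg : DependsOn g (inside G T)) : IndepFun f g μ := by
  obtain ⟨f', hf'⟩ := exists_comp_of_dependsOn hf
  obtain ⟨g', hg'⟩ := exists_comp_of_dependsOn hg
  have := (finite_inside (G := G) hS).to_subtype
  have := (finite_inside (G := G) hT).to_subtype
  have := (hμ _ _ (kDistant_inside hST)).comp (measurable_of_finite f') (measurable_of_finite g')
  rwa [show f = f' ∘ _ from funext hf', show g = g' ∘ _ from funext hg']

lemma KIndependent.measureReal_inter (hμ : KIndependent G 1 μ) {S T : Set V}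
    (hS : S.Finite) (hT : T.Finite) (hST : Disjoint S T) {A B : Set (Configuration G)}
    (hA : DependsOn (· ∈ A) (inside G S)) (hB : DependsOn (· ∈ B) (inside G T)) :
    μ.real (A ∩ B) = μ.real A * μ.real B := by
  have := (hμ.indepFun hS hT hST hA hB).measure_inter_preimage_eq_mul {True} {True}
    (MeasurableSet.of_discrete) (MeasurableSet.of_discrete)
  have e : ∀ A : Set (Configuration G), (· ∈ A) ⁻¹' {True} = A := by
    intro A; ext ω; simp
  rw [e, e] at this
  rw [measureReal_def, this, ENNReal.toReal_mul]
  rfl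

lemma integrable_of_dependsOn [IsFiniteMeasure μ] {S : Set V} (hS : S.Finite)
    {f : Configuration G → ℝ} (hf : DependsOn f (inside G S)) : Integrable f μ := by
  obtain ⟨g, hg⟩ := exists_comp_of_dependsOn hf
  have := (finite_inside (G := G) hS).to_subtype
  rw [show f = g ∘ fun ω (e : inside G S) => ω e from funext hg]
  exact Integrable.comp_measurable (Integrable.of_finite)
    (measurable_pi_lambda _ fun e => measurable_pi_apply _)

lemma KIndependent.integral_mul [IsFiniteMeasure μ] (hμ : KIndependent G 1 μ) {S T : Set V}
    (hS : S.Finite) (hT : T.Finite) (hST : Disjoint S T) {f g : Configuration G → ℝ}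
    (hf : DependsOn f (inside G S)) (hg : DependsOn g (inside G T)) :
    ∫ ω, f ω * g ω ∂μ = (∫ ω, f ω ∂μ) * ∫ ω, g ω ∂μ :=
  (hμ.indepFun hS hT hST hf hg).integral_fun_mul_eq_mul_integral
    (measurable_of_dependsOn hS hf).aestronglyMeasurable
    (measurable_of_dependsOn hT hg).aestronglyMeasurable

end Independence

lemma le_measureReal_open {μ : Measure (Configuration G)} {p : ℝ} (hμ : μ ∈ modelsGE 1 p G)
    {u v : V} (h : G.Adj u v) : p ≤ μ.real {ω | (openSubgraph G ω).Adj u v} := by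
  obtain ⟨_, -, h2⟩ := hμ
  have h3 := h2.trans (iInf_le _ ⟨s(u, v), h⟩)
  have : {ω : Configuration G | (openSubgraph G ω).Adj u v} = {ω | ω ⟨s(u, v), h⟩ = true} := by
    ext ω
    simp [openSubgraph_adj, h]
  rw [this, measureReal_def]
  exact (ENNReal.ofReal_le_iff_le_toReal (measure_ne_top _ _)).1 h3

lemma modelsGE_anti {p q : ℝ} (h : p ≤ q) : modelsGE 1 q G ⊆ modelsGE 1 p G :=
  fun _ ⟨h1, h2, h3⟩ => ⟨h1, h2, (ENNReal.ofReal_le_ofReal h).trans h3⟩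

lemma mem_openPathEvent_iff {n : ℕ} {ω : Configuration G} :
    ω ∈ openPathEvent G n ↔
      ∃ l : List V, l.length = n + 1 ∧ l.Nodup ∧ l.IsChain (openSubgraph G ω).Adj := by
  constructor
  · rintro ⟨u, v, w, hw, rfl⟩
    exact ⟨w.support, by simp, hw.support_nodup, w.isChain_adj_support⟩
  · rintro ⟨l, hl, hd, hc⟩
    have hne : l ≠ [] := by rintro rfl; simp at hl
    refine ⟨_, _, SimpleGraph.Walk.ofSupport l hne hc, ?_, ?_⟩
    · rw [SimpleGraph.Walk.isPath_def, SimpleGraph.Walk.support_ofSupport]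
      exact hd
    · rw [SimpleGraph.Walk.length_ofSupport, hl]
      rfl

/-- There are countably many vertex lists, and each one involves finitely many edges. -/
lemma measurableSet_openPathEvent [Countable V] (n : ℕ) :
    MeasurableSet (openPathEvent G n) := by
  have : openPathEvent G n = ⋃ l : List V, {ω | l.length = n + 1 ∧ l.Nodup ∧
      l.IsChain (openSubgraph G ω).Adj} := by
    ext ω
    simp [mem_openPathEvent_iff]
  rw [this]
  refine MeasurableSet.iUnion fun l => ?_
  refine measurableSet_of_dependsOn (S := {v | v ∈ l}) l.finite_toSet ?_
  intro ω ω' h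
  simp only [Set.mem_ofPred_eq, eq_iff_iff]
  refine and_congr_right fun _ => and_congr_right fun _ => ?_
  simp only [List.isChain_iff_getElem]
  refine forall_congr' fun i => forall_congr' fun hi => ?_
  exact adj_congr h (List.getElem_mem _) (List.getElem_mem _)

/-- The edge probabilities which force arbitrarily long open paths in `1`-independent models. -/
def longPathProbs (G : SimpleGraph V) : Set ℝ :=
  {p : ℝ | p ∈ Set.Icc (0 : ℝ) 1 ∧
    ∀ μ ∈ modelsGE 1 p G, ∀ n : ℕ, 0 < μ (openPathEvent G n)}

lemma bddBelow_longPathProbs (G : SimpleGraph V) : BddBelow (longPathProbs G) :=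
  ⟨0, fun _ h => h.1.1⟩

lemma longPathsCritProb_le {p : ℝ} (h : p ∈ longPathProbs G) : longPathsCritProb G ≤ p :=
  csInf_le (bddBelow_longPathProbs G) h

section Pullback

variable {H : SimpleGraph W} (φ : G →g H)

/-- The restriction of a configuration along a graph homomorphism. -/
def pullback (ω : Configuration H) : Configuration G := fun e => ω (φ.mapEdgeSet e)

lemma measurable_pullback : Measurable (pullback φ) :=
  measurable_pi_lambda _ fun _ => measurable_pi_apply _

lemma mapEdgeSet_mem {e : G.edgeSet} {v : W} :
    v ∈ (φ.mapEdgeSet e : Sym2 W) ↔ ∃ u ∈ (e : Sym2 V), φ u = v := by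
  simp [SimpleGraph.Hom.mapEdgeSet]

/-- Injectivity keeps the images of vertex-disjoint edges vertex-disjoint, so restricting a model
preserves 1-independence. -/
lemma pullback_mem_modelsGE {φ : G →g H} (hφ : Function.Injective φ) {p : ℝ}
    {μ : Measure (Configuration H)} (hμ : μ ∈ modelsGE 1 p H) :
    μ.map (pullback φ) ∈ modelsGE 1 p G := by
  obtain ⟨hprob, hind, hp⟩ := hμ
  refine ⟨Measure.isProbabilityMeasure_map (measurable_pullback φ).aemeasurable, ?_, ?_⟩
  · intro F₁ F₂ hF
    have hd : KDistant H 1 (φ.mapEdgeSet '' F₁) (φ.mapEdgeSet '' F₂) := by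
      rw [kDistant_one_iff] at hF ⊢
      rintro _ ⟨e, he, rfl⟩ _ ⟨f, hf, rfl⟩ v hv hv'
      obtain ⟨u, hu, rfl⟩ := (mapEdgeSet_mem φ).1 hv
      obtain ⟨u', hu', h⟩ := (mapEdgeSet_mem φ).1 hv'
      exact hF e he f hf u hu (hφ h ▸ hu')
    have hr : ∀ F : Set G.edgeSet, Measurable fun (x : (φ.mapEdgeSet '' F) → Bool) (e : F) =>
        x ⟨φ.mapEdgeSet e, Set.mem_image_of_mem _ e.2⟩ :=
      fun F => measurable_pi_lambda _ fun e => measurable_pi_apply _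
    have hm : ∀ F : Set G.edgeSet, Measurable fun (ω : Configuration G) (e : F) => ω e :=
      fun F => measurable_pi_lambda _ fun e => measurable_pi_apply _
    have key := (hind _ _ hd).comp (hr F₁) (hr F₂)
    rw [indepFun_iff_measure_inter_preimage_eq_mul] at key ⊢
    intro s t hs ht
    have h1 := key s t hs ht
    rw [Measure.map_apply (measurable_pullback φ) ((hm F₁ hs).inter (hm F₂ ht)),
      Measure.map_apply (measurable_pullback φ) (hm F₁ hs),
      Measure.map_apply (measurable_pullback φ) (hm F₂ ht)]
    exact h1
  · refine le_iInf fun e => ?_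
    rw [Measure.map_apply (measurable_pullback φ)
      (measurableSet_eq_fun (measurable_pi_apply e) measurable_const)]
    exact hp.trans (iInf_le _ (φ.mapEdgeSet e))

/-- An open path of the restricted model is mapped to an open path of the same length in `H`. -/
lemma longPathProbs_subset [Countable V] {φ : G →g H} (hφ : Function.Injective φ) :
    longPathProbs G ⊆ longPathProbs H := by
  rintro p ⟨hp, h⟩
  refine ⟨hp, fun μ hμ n => ?_⟩
  have h1 := h _ (pullback_mem_modelsGE hφ hμ) n
  rw [Measure.map_apply (measurable_pullback φ) (measurableSet_openPathEvent n)] at h1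
  refine h1.trans_le (measure_mono ?_)
  intro ω hω
  obtain ⟨l, hl, hd, hc⟩ := mem_openPathEvent_iff.1 hω
  refine mem_openPathEvent_iff.2 ⟨l.map φ, by simpa using hl, hd.map hφ, ?_⟩
  rw [List.isChain_map]
  refine hc.imp fun u v huv => ?_
  obtain ⟨h1, h2⟩ := openSubgraph_adj.1 huv
  exact openSubgraph_adj.2 ⟨φ.map_adj h1, h2⟩

end Pullback

end Basics
-- Levels of the product and the two-step recursion
section Line

variable {V : Type*} {G : SimpleGraph V}

lemma intLine_adj {a b : ℤ} : intLine.Adj a b ↔ b = a + 1 ∨ a = b + 1 := by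
  simp only [intLine, SimpleGraph.fromRel_adj]
  omega

lemma lineProd_adj {x y : ℤ × V} : (lineProd G).Adj x y ↔
    (y.1 = x.1 + 1 ∨ x.1 = y.1 + 1) ∧ x.2 = y.2 ∨ G.Adj x.2 y.2 ∧ x.1 = y.1 := by
  rw [lineProd, SimpleGraph.boxProd_adj, intLine_adj]

/-- The embedding of `G` as a level of `lineProd G`. -/
def levelHom (G : SimpleGraph V) (k : ℤ) : G →g lineProd G where
  toFun v := (k, v)
  map_rel' h := lineProd_adj.2 (Or.inr ⟨h, rfl⟩)

lemma levelHom_injective (k : ℤ) : Function.Injective (levelHom G k) :=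
  fun _ _ h => (Prod.ext_iff.1 h).2

/-- The open graph on the level `k`. -/
def slice (ω : Configuration (lineProd G)) (k : ℤ) : SimpleGraph V :=
  openSubgraph G (pullback (levelHom G k) ω)

lemma slice_adj {ω : Configuration (lineProd G)} {k : ℤ} {u v : V} :
    (slice ω k).Adj u v ↔ (openSubgraph (lineProd G) ω).Adj (k, u) (k, v) := by
  rw [slice, openSubgraph_adj, openSubgraph_adj]
  constructor
  · rintro ⟨h, h'⟩
    exact ⟨(levelHom G k).map_adj h, h'⟩
  · rintro ⟨h, h'⟩
    have h2 : G.Adj u v := by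
      rcases lineProd_adj.1 h with ⟨h1, -⟩ | ⟨h1, -⟩
      · simp only at h1; omega
      · exact h1
    exact ⟨h2, h'⟩

/-- The open edge joining the copies of `v` in the levels `k` and `k + 1`. -/
def Rung (ω : Configuration (lineProd G)) (k : ℤ) (v : V) : Prop :=
  (openSubgraph (lineProd G) ω).Adj (k, v) (k + 1, v)

/-- The vertices in the levels from `a` to `b`. -/
def levels (V : Type*) (a b : ℤ) : Set (ℤ × V) := {x | a ≤ x.1 ∧ x.1 ≤ b}

lemma finite_levels [Finite V] (a b : ℤ) : (levels V a b).Finite := by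
  refine ((Set.finite_Icc a b).prod (Set.finite_univ (α := V))).subset ?_
  rintro x ⟨h1, h2⟩
  exact ⟨⟨h1, h2⟩, trivial⟩

lemma levels_subset {a b c d : ℤ} (h1 : c ≤ a) (h2 : b ≤ d) : levels V a b ⊆ levels V c d :=
  fun _ ⟨h3, h4⟩ => ⟨h1.trans h3, h4.trans h2⟩

lemma disjoint_levels {a b c d : ℤ} (h : b < c) : Disjoint (levels V a b) (levels V c d) := by
  rw [Set.disjoint_left]
  rintro x ⟨_, h2⟩ ⟨h3, _⟩
  omega

lemma dependsOn_slice (k : ℤ) :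
    DependsOn (fun ω => slice (G := G) ω k) (inside (lineProd G) (levels V k k)) := by
  intro ω ω' h
  ext u v
  rw [slice_adj, slice_adj]
  exact adj_congr h ⟨le_rfl, le_rfl⟩ ⟨le_rfl, le_rfl⟩

lemma dependsOn_rung (k : ℤ) :
    DependsOn (fun ω => Rung (G := G) ω k) (inside (lineProd G) (levels V k (k + 1))) := by
  intro ω ω' h
  ext v
  exact adj_congr h ⟨le_rfl, by simp⟩ ⟨by simp, le_rfl⟩

lemma slice_eq {a b : ℤ} {ω ω' : Configuration (lineProd G)}
    (h : ∀ e ∈ inside (lineProd G) (levels V a b), ω e = ω' e) {k : ℤ} (hk : a ≤ k ∧ k ≤ b) :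
    slice ω k = slice ω' k :=
  (dependsOn_slice (G := G) k).mono (inside_mono (levels_subset hk.1 hk.2)) h

lemma rung_eq {a b : ℤ} {ω ω' : Configuration (lineProd G)}
    (h : ∀ e ∈ inside (lineProd G) (levels V a b), ω e = ω' e) {k : ℤ} (hk : a ≤ k ∧ k < b) :
    Rung ω k = Rung ω' k :=
  (dependsOn_rung (G := G) k).mono (inside_mono (levels_subset hk.1 (by omega))) h

lemma reachable_of_slice {ω : Configuration (lineProd G)} {k : ℤ} {u v : V}
    (h : (slice ω k).Reachable u v) :
    (openSubgraph (lineProd G) ω).Reachable (k, u) (k, v) :=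
  h.map (⟨fun v => (k, v), fun h => slice_adj.1 h⟩ :
    slice ω k →g openSubgraph (lineProd G) ω)

lemma level_le_add_length {ω : Configuration (lineProd G)} {x y : ℤ × V}
    (w : (openSubgraph (lineProd G) ω).Walk x y) : y.1 ≤ x.1 + w.length := by
  induction w with
  | nil => simp
  | cons h w ih =>
    rw [SimpleGraph.Walk.length_cons]
    rcases lineProd_adj.1 (openSubgraph_le _ h) with ⟨h1, -⟩ | ⟨-, h1⟩ <;> push_cast <;> omega

/-- Every edge changes the level by at most one, so a path from `x` to `y` has at least `n` edges
and can be truncated. -/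
lemma mem_openPathEvent_of_reachable {ω : Configuration (lineProd G)} {x y : ℤ × V} {n : ℕ}
    (h : (openSubgraph (lineProd G) ω).Reachable x y) (hn : x.1 + n ≤ y.1) :
    ω ∈ openPathEvent (lineProd G) n := by
  classical
  obtain ⟨w, hw⟩ := h.exists_isPath
  have h1 := level_le_add_length w
  exact ⟨_, _, w.take n, hw.take n, by rw [SimpleGraph.Walk.take_length]; omega⟩

lemma levels_measureReal_inter [Finite V] {μ : Measure (Configuration (lineProd G))}
    (hμ : KIndependent (lineProd G) 1 μ) {a b c d : ℤ} (hbc : b < c)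
    {A B : Set (Configuration (lineProd G))}
    (hA : DependsOn (· ∈ A) (inside (lineProd G) (levels V a b)))
    (hB : DependsOn (· ∈ B) (inside (lineProd G) (levels V c d))) :
    μ.real (A ∩ B) = μ.real A * μ.real B :=
  hμ.measureReal_inter (finite_levels _ _) (finite_levels _ _) (disjoint_levels hbc) hA hB

/-- Rungs over different vertices share no vertex, so they can be split off one at a time by
independence. -/
lemma measureReal_forall_not_rung_le [Finite V] {μ : Measure (Configuration (lineProd G))}
    {p : ℝ} (hp : p ≤ 1) (hμ : μ ∈ modelsGE 1 p (lineProd G)) (k : ℤ) (s : Finset V) :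
    μ.real {ω | ∀ v ∈ s, ¬ Rung ω k v} ≤ (1 - p) ^ s.card := by
  classical
  have := hμ.1
  induction s using Finset.induction_on with
  | empty => simp
  | insert v s hv ih =>
    have e : {ω : Configuration (lineProd G) | ∀ u ∈ insert v s, ¬ Rung ω k u} =
        {ω | ¬ Rung ω k v} ∩ {ω | ∀ u ∈ s, ¬ Rung ω k u} := by
      ext ω; simp
    have d1 : DependsOn (· ∈ {ω : Configuration (lineProd G) | ¬ Rung ω k v})
        (inside (lineProd G) {x | x.2 = v ∧ x ∈ levels V k (k + 1)}) := by
      intro ω ω' h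
      simp only [Set.mem_ofPred_eq, eq_iff_iff, Rung]
      rw [adj_congr h ⟨rfl, by simp [levels]⟩ ⟨rfl, by simp [levels]⟩]
    have d2 : DependsOn (· ∈ {ω : Configuration (lineProd G) | ∀ u ∈ s, ¬ Rung ω k u})
        (inside (lineProd G) {x | x.2 ∈ s ∧ x ∈ levels V k (k + 1)}) := by
      intro ω ω' h
      simp only [Set.mem_ofPred_eq, eq_iff_iff, Rung]
      refine forall_congr' fun u => forall_congr' fun hu => ?_
      rw [adj_congr h ⟨hu, by simp [levels]⟩ ⟨hu, by simp [levels]⟩]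
    have f1 : {x : ℤ × V | x.2 = v ∧ x ∈ levels V k (k + 1)}.Finite :=
      (finite_levels k (k + 1)).subset fun _ h => h.2
    rw [e, hμ.2.1.measureReal_inter f1 ((finite_levels k (k + 1)).subset fun _ h => h.2)
      (Set.disjoint_left.2 fun x h1 h2 => hv (h1.1 ▸ h2.1)) d1 d2, Finset.card_insert_of_notMem hv,
      pow_succ']
    have h1 : μ.real {ω : Configuration (lineProd G) | ¬ Rung ω k v} ≤ 1 - p := by
      have d3 : MeasurableSet {ω : Configuration (lineProd G) | ¬ Rung ω k v} :=
        measurableSet_of_dependsOn f1 d1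
      have h2 := probReal_compl_eq_one_sub (μ := μ) d3
      have h3 := le_measureReal_open hμ
        (lineProd_adj (x := (k, v)) (y := (k + 1, v)).2 (Or.inl ⟨Or.inl rfl, rfl⟩))
      have h4 : {ω : Configuration (lineProd G) | ¬ Rung ω k v}ᶜ =
          {ω | (openSubgraph (lineProd G) ω).Adj (k, v) (k + 1, v)} := by
        ext ω; simp [Rung]
      rw [h4] at h2
      linarith
    exact mul_le_mul h1 ih measureReal_nonneg (by linarith)

/-- Induction on positivity alone fails. The ratio bound `x (k + 1) ≥ f / 2 * x k` reproduces
itself, `f / 2` being the double root of `t ^ 2 - f * t + g` in the critical case `4 * g = f ^ 2`.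
-/
lemma pos_of_two_step_recursion {x : ℕ → ℝ} {f g : ℝ} (hf : 0 < f) (hfg : 4 * g ≤ f ^ 2)
    (h0 : x 0 = 1) (h1 : f / 2 ≤ x 1)
    (h2 : ∀ k, f * x (k + 1) - g * x k ≤ x (k + 2)) (k : ℕ) : 0 < x k := by
  suffices h : ∀ k, 0 < x k ∧ f / 2 * x k ≤ x (k + 1) from (h k).1
  intro k
  induction k with
  | zero => exact ⟨by rw [h0]; norm_num, by rw [h0]; linarith⟩
  | succ k ih =>
    obtain ⟨ih1, ih2⟩ := ih
    refine ⟨lt_of_lt_of_le (by positivity) ih2, le_trans ?_ (h2 k)⟩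
    have h3 : g * x k ≤ f / 2 * x (k + 1) := by
      calc g * x k ≤ f ^ 2 / 4 * x k := by gcongr; linarith
        _ = f / 2 * (f / 2 * x k) := by ring
        _ ≤ f / 2 * x (k + 1) := by gcongr
    linarith

/-- Enough that every level is connected with probability at least `f`, if `f ^ 2` is at least four
times the probability that two consecutive levels are not joined. -/
theorem mem_longPathProbs_lineProd [Fintype V] [Nonempty V] {p f : ℝ} (hp : p ∈ Set.Icc (0 : ℝ) 1)
    (hf : 0 < f) (hfp : 4 * (1 - p) ^ Fintype.card V ≤ f ^ 2)
    (hconn : ∀ μ ∈ modelsGE 1 p G, f ≤ μ.real {ω | (openSubgraph G ω).Preconnected}) :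
    p ∈ longPathProbs (lineProd G) := by
  refine ⟨hp, fun μ hμ n => ?_⟩
  have := hμ.1
  set X : ℕ → Set (Configuration (lineProd G)) := fun k => {ω | (slice ω k).Preconnected}
  set H : ℕ → Set (Configuration (lineProd G)) := fun k => {ω | ∃ v, Rung ω k v}
  set A : ℕ → Set (Configuration (lineProd G)) := fun k =>
    {ω | (∀ i < k, ω ∈ X i) ∧ ∀ i, i + 1 < k → ω ∈ H i}
  have hX : ∀ k, f ≤ μ.real (X k) := by
    intro k
    have h1 := hconn _ (pullback_mem_modelsGE (levelHom_injective (G := G) k) hμ)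
    rw [measureReal_def, Measure.map_apply (measurable_pullback _)
      (measurableSet_of_dependsOn Set.finite_univ ?_)] at h1
    · exact h1
    · intro ω ω' h
      have : ω = ω' := funext fun e => h e fun v _ => Set.mem_univ v
      rw [this]
  have dX : ∀ k : ℕ, DependsOn (· ∈ X k) (inside (lineProd G) (levels V k k)) := by
    intro k ω ω' h
    simp only [X, Set.mem_ofPred_eq, slice_eq h ⟨le_rfl, le_rfl⟩]
  have dH : ∀ k : ℕ, DependsOn (· ∈ (H k)ᶜ) (inside (lineProd G) (levels V k (k + 1))) := by
    intro k ω ω' h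
    simp only [H, Set.mem_compl_iff, Set.mem_ofPred_eq, rung_eq h ⟨le_rfl, lt_add_one _⟩]
  -- The block ends at level `k - 1` (and is empty for `k = 0`), so `A k` is independent both of `X
  -- k` and of `H k`, which begin at level `k`.
  have dA : ∀ k : ℕ, DependsOn (· ∈ A k) (inside (lineProd G) (levels V 0 (k - 1))) := by
    intro k ω ω' h
    simp only [A, X, H, Set.mem_ofPred_eq, eq_iff_iff]
    refine and_congr (forall_congr' fun i => forall_congr' fun hi => ?_)
      (forall_congr' fun i => forall_congr' fun hi => ?_)
    · rw [slice_eq h ⟨by omega, by omega⟩]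
    · rw [rung_eq h ⟨by omega, by omega⟩]
  have hH : ∀ k, μ.real (H k)ᶜ ≤ (1 - p) ^ Fintype.card V := by
    intro k
    convert measureReal_forall_not_rung_le hp.2 hμ k Finset.univ using 2
    · ext ω; simp [H]
    · rfl
  have hAX : ∀ k, f * μ.real (A k) ≤ μ.real (A k ∩ X k) := by
    intro k
    rw [levels_measureReal_inter hμ.2.1 (by omega) (dA k) (dX k), mul_comm]
    exact mul_le_mul_of_nonneg_left (hX k) measureReal_nonneg
  have hAH : ∀ k, μ.real (A k ∩ (H k)ᶜ) ≤ (1 - p) ^ Fintype.card V * μ.real (A k) := by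
    intro k
    rw [levels_measureReal_inter hμ.2.1 (by omega) (dA k) (dH k), mul_comm]
    exact mul_le_mul_of_nonneg_right (hH k) measureReal_nonneg
  have hpos : ∀ k, 0 < μ.real (A k) := by
    refine pos_of_two_step_recursion hf hfp ?_ ?_ ?_
    · simp [A]
    · have h1 := hX 0
      have : A 1 = X 0 := by
        ext ω; simp [A]
      rw [this]
      linarith
    · intro k
      -- In the failure case level `k` is forgotten: weakening `A (k + 1)` to `A k` is what makes it
      -- independent of `H k`.
      have h1 : A (k + 1) ∩ X (k + 1) ⊆ A (k + 2) ∪ (A k ∩ (H k)ᶜ) := by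
        rintro ω ⟨⟨h1, h2⟩, h3⟩
        by_cases h : ω ∈ H k
        · left
          refine ⟨fun i hi => ?_, fun i hi => ?_⟩
          · rcases (by omega : i < k + 1 ∨ i = k + 1) with h | rfl
            · exact h1 i h
            · exact h3
          · rcases (by omega : i + 1 < k + 1 ∨ i = k) with h | rfl
            · exact h2 i h
            · assumption
        · exact Or.inr ⟨⟨fun i hi => h1 i (by omega), fun i hi => h2 i (by omega)⟩, h⟩
      have h2 := (measureReal_mono h1).trans (measureReal_union_le (μ := μ) _ _)
      linarith [hAX (k + 1), hAH k]
  have hsub : A (n + 1) ⊆ openPathEvent (lineProd G) n := by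
    rintro ω ⟨h1, h2⟩
    have u := Classical.arbitrary V
    have key : ∀ i : ℕ, i < n + 1 →
        ∀ v, (openSubgraph (lineProd G) ω).Reachable ((0 : ℕ), u) ((i : ℤ), v) := by
      intro i
      induction i with
      | zero => exact fun hi v => reachable_of_slice (h1 0 hi u v)
      | succ i ih =>
        intro hi v
        obtain ⟨w, hw⟩ := h2 i (by omega)
        refine (ih (by omega) w).trans (hw.reachable.trans ?_)
        have := reachable_of_slice (h1 (i + 1) hi w v)
        push_cast at this ⊢
        exact this
    exact mem_openPathEvent_of_reachable (key n (by omega) u) (by simp)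
  refine lt_of_lt_of_le ?_ (measure_mono hsub)
  exact (ENNReal.toReal_pos_iff.1 (hpos (n + 1))).1

end Line

/-! ### Probability that a cycle is connected -/

section Cycle

open SimpleGraph

open scoped Fin.NatCast in
-- Starting at `j + 1`, one walks round the cycle and reaches `j` last, never using the edge from
-- `j` to `j + 1`.
lemma preconnected_of_forall_ne_adj {n : ℕ} {G : SimpleGraph (Fin (n + 1))} (j : Fin (n + 1))
    (h : ∀ i, i ≠ j → G.Adj i (i + 1)) : G.Preconnected := by
  have key : ∀ m : ℕ, m ≤ n → G.Reachable (j + 1) (j + 1 + (m : Fin (n + 1))) := by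
    intro m
    induction m with
    | zero => intro _; simp
    | succ m ih =>
      intro hm
      refine (ih (by omega)).trans ?_
      have : j + 1 + (m : Fin (n + 1)) ≠ j := by
        intro h
        have h1 : ((m + 1 : ℕ) : Fin (n + 1)) = 0 := by
          push_cast
          have : j + (1 + (m : Fin (n + 1))) = j + 0 := by rw [← add_assoc, h, add_zero]
          rw [add_comm (m : Fin (n + 1))]
          exact add_left_cancel this
        rw [Fin.natCast_eq_zero] at h1
        exact absurd (Nat.le_of_dvd (by omega) h1) (by omega)
      have h2 := (h _ this).reachable
      push_cast
      rwa [← add_assoc]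
  have key' : ∀ v, G.Reachable (j + 1) v := by
    intro v
    have := key (v - (j + 1) : Fin (n + 1)).val (by omega)
    rwa [Fin.cast_val_eq_self, add_sub_cancel] at this
  exact fun u v => (key' u).symm.trans (key' v)

lemma dependsOn_univ_inside {V α : Type*} {G : SimpleGraph V} (f : Configuration G → α) :
    DependsOn f (inside G Set.univ) :=
  fun _ _ h => congrArg f (funext fun e => h e fun v _ => Set.mem_univ v)

variable {n : ℕ}

lemma cycleGraph_adj_add_one (i : Fin (n + 3)) : (cycleGraph (n + 3)).Adj i (i + 1) := by
  rw [cycleGraph_adj]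
  right
  simp

/-- The indicator of the event that the edge from `i` to `i + 1` is open. -/
noncomputable def cycleEdge (i : Fin (n + 3)) : Configuration (cycleGraph (n + 3)) → ℝ :=
  Set.indicator {ω | (openSubgraph _ ω).Adj i (i + 1)} 1

lemma cycleEdge_eq_zero_or_one (i : Fin (n + 3)) (ω : Configuration (cycleGraph (n + 3))) :
    cycleEdge i ω = 0 ∨ cycleEdge i ω = 1 ∧ (openSubgraph _ ω).Adj i (i + 1) := by
  by_cases h : (openSubgraph _ ω).Adj i (i + 1)
  · exact Or.inr ⟨by simp [cycleEdge, Set.indicator, h], h⟩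
  · exact Or.inl (by simp [cycleEdge, Set.indicator, h])

lemma le_integral_cycleEdge {p : ℝ} {μ : Measure (Configuration (cycleGraph (n + 3)))}
    (hμ : μ ∈ modelsGE 1 p (cycleGraph (n + 3))) (i : Fin (n + 3)) :
    p ≤ ∫ ω, cycleEdge i ω ∂μ := by
  rw [cycleEdge, integral_indicator_one]
  · exact le_measureReal_open hμ (cycleGraph_adj_add_one i)
  · exact measurableSet_of_dependsOn Set.finite_univ (dependsOn_univ_inside _)

lemma integrable_univ {G : SimpleGraph (Fin n)} {μ : Measure (Configuration G)}
    [IsFiniteMeasure μ] (f : Configuration G → ℝ) : Integrable f μ :=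
  integrable_of_dependsOn Set.finite_univ (dependsOn_univ_inside f)

/-- The indicator of the event that all vertices of the cycle are joined by open paths. -/
noncomputable def cycleConn : Configuration (cycleGraph (n + 3)) → ℝ :=
  Set.indicator {ω | (openSubgraph _ ω).Preconnected} 1

lemma integral_cycleConn {μ : Measure (Configuration (cycleGraph (n + 3)))} :
    ∫ ω, cycleConn ω ∂μ = μ.real {ω | (openSubgraph _ ω).Preconnected} := by
  rw [cycleConn, integral_indicator_one]
  exact measurableSet_of_dependsOn Set.finite_univ (dependsOn_univ_inside _)

lemma cycleConn_nonneg (ω : Configuration (cycleGraph (n + 3))) : 0 ≤ cycleConn ω :=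
  Set.indicator_nonneg (fun _ _ => zero_le_one) _

lemma cycleConn_eq_one {ω : Configuration (cycleGraph (n + 3))} (j : Fin (n + 3))
    (h : ∀ i, i ≠ j → cycleEdge i ω = 1) : cycleConn ω = 1 := by
  have : (openSubgraph _ ω).Preconnected := by
    refine preconnected_of_forall_ne_adj j fun i hi => ?_
    rcases cycleEdge_eq_zero_or_one i ω with h1 | h1
    · rw [h i hi] at h1; norm_num at h1
    · exact h1.2
  simp [cycleConn, Set.indicator, this]

/-- A disconnected configuration has at least two closed edges, hence at most `n + 1` open ones; a
connected one has at most `n + 3`. -/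
lemma sum_cycleEdge_le (ω : Configuration (cycleGraph (n + 3))) :
    ∑ i, cycleEdge i ω ≤ (n + 1 : ℝ) + 2 * cycleConn ω := by
  classical
  have hle : ∀ i, cycleEdge i ω ≤ 1 := fun i => by
    rcases cycleEdge_eq_zero_or_one i ω with h | h <;> simp [h]
  by_cases h : ∃ j k, j ≠ k ∧ cycleEdge j ω = 0 ∧ cycleEdge k ω = 0
  · obtain ⟨j, k, hjk, hj, hk⟩ := h
    have h1 : ∑ i, cycleEdge i ω = ∑ i ∈ (Finset.univ.erase j).erase k, cycleEdge i ω := by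
      rw [Finset.sum_erase (f := fun i => cycleEdge i ω) _ hk,
        Finset.sum_erase (f := fun i => cycleEdge i ω) _ hj]
    have h2 := Finset.sum_le_card_nsmul ((Finset.univ.erase j).erase k)
      (fun i => cycleEdge i ω) 1 fun i _ => hle i
    rw [Finset.card_erase_of_mem (by simp [hjk.symm]), Finset.card_erase_of_mem (by simp),
      Finset.card_univ, Fintype.card_fin] at h2
    rw [h1]
    have := cycleConn_nonneg ω
    simp at h2
    linarith
  · push Not at h
    have h1 : cycleConn ω = 1 := by
      by_cases h0 : ∃ j, cycleEdge j ω = 0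
      · obtain ⟨j, hj⟩ := h0
        refine cycleConn_eq_one j fun i hi => ?_
        exact ((cycleEdge_eq_zero_or_one i ω).resolve_left (h j i hi.symm hj)).1
      · push Not at h0
        exact cycleConn_eq_one 0 fun i _ =>
          ((cycleEdge_eq_zero_or_one i ω).resolve_left (h0 i)).1
    have h2 := Finset.sum_le_card_nsmul Finset.univ (fun i => cycleEdge i ω) 1 fun i _ => hle i
    simp at h2
    linarith

theorem le_measureReal_cycle_preconnected {p : ℝ}
    {μ : Measure (Configuration (cycleGraph (n + 3)))}
    (hμ : μ ∈ modelsGE 1 p (cycleGraph (n + 3))) :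
    ((n + 3) * p - (n + 1)) / 2 ≤ μ.real {ω | (openSubgraph _ ω).Preconnected} := by
  have := hμ.1
  rw [← integral_cycleConn]
  have h1 := integral_mono (μ := μ) (integrable_univ _) (integrable_univ _) sum_cycleEdge_le
  rw [integral_finsetSum _ fun i _ => integrable_univ _,
    integral_add (integrable_univ _) (integrable_univ _), integral_const_mul] at h1
  have h2 := Finset.card_nsmul_le_sum Finset.univ (fun i => ∫ ω, cycleEdge i ω ∂μ) p
    fun i _ => le_integral_cycleEdge hμ i
  simp at h1 h2
  linarith

section FiveCycle

/-- A nonnegative function of the path opposite to an edge of the five-cycle. -/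
noncomputable def oppositeWeight (p a b : ℝ) : ℝ :=
  (3 * p ^ 2 - 1) + 3 / 2 * (1 + p) * (a + b) - 3 * a * b

lemma oppositeWeight_nonneg {p a b : ℝ} (hp : 1 ≤ 3 * p ^ 2) (hp' : 0 ≤ p) (ha : a = 0 ∨ a = 1)
    (hb : b = 0 ∨ b = 1) : 0 ≤ oppositeWeight p a b := by
  rcases ha with rfl | rfl <;> rcases hb with rfl | rfl <;> simp only [oppositeWeight] <;> linarith

/-- The weights act as dual multipliers for the constraints that each edge, given the opposite path
of two edges, is open with probability at least `p`. They are tuned so that equality holds when all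
edges are open (`c = 1`), and when all or exactly two are closed (`c = 0`). -/
lemma five_cycle_bound {p : ℝ} (hp : 1 / 2 ≤ p) {x₀ x₁ x₂ x₃ x₄ c : ℝ} (hc : 0 ≤ c)
    (h₀ : x₀ = 0 ∨ x₀ = 1) (h₁ : x₁ = 0 ∨ x₁ = 1) (h₂ : x₂ = 0 ∨ x₂ = 1) (h₃ : x₃ = 0 ∨ x₃ = 1)
    (h₄ : x₄ = 0 ∨ x₄ = 1) (hx : 4 ≤ x₀ + x₁ + x₂ + x₃ + x₄ → c = 1) :
    5 * p * (3 * p ^ 2 - 1) + ((x₀ - p) * oppositeWeight p x₂ x₃ +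
      (x₁ - p) * oppositeWeight p x₃ x₄ + (x₂ - p) * oppositeWeight p x₄ x₀ +
      (x₃ - p) * oppositeWeight p x₀ x₁ + (x₄ - p) * oppositeWeight p x₁ x₂) ≤
      5 * (3 * p - 1) * c := by
  have hs : 0 ≤ 5 * (3 * p - 1) * c := mul_nonneg (by linarith) hc
  unfold oppositeWeight
  rcases h₀ with rfl | rfl <;> rcases h₁ with rfl | rfl <;> rcases h₂ with rfl | rfl <;>
    rcases h₃ with rfl | rfl <;> rcases h₄ with rfl | rfl <;> norm_num at hx ⊢ <;>
    first | linarith | (rw [hx]; linarith)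

theorem le_measureReal_five_cycle_preconnected {p : ℝ} (hp : 1 / 2 ≤ p) (hp' : 1 ≤ 3 * p ^ 2)
    {μ : Measure (Configuration (cycleGraph 5))} (hμ : μ ∈ modelsGE 1 p (cycleGraph 5)) :
    p * (3 * p ^ 2 - 1) / (3 * p - 1) ≤ μ.real {ω | (openSubgraph _ ω).Preconnected} := by
  have := hμ.1
  set e : Fin 5 → Configuration (cycleGraph 5) → ℝ := cycleEdge (n := 2) with he
  set c : Configuration (cycleGraph 5) → ℝ := cycleConn (n := 2) with hc
  have he01 : ∀ i ω, e i ω = 0 ∨ e i ω = 1 := fun i ω =>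
    (cycleEdge_eq_zero_or_one (n := 2) i ω).imp_right And.left
  have hc1 : ∫ ω, c ω ∂μ = μ.real {ω | (openSubgraph _ ω).Preconnected} := integral_cycleConn
  have hone : ∀ i ω, (openSubgraph _ ω).Adj i (i + 1) → e i ω = 1 := fun i ω h =>
    Set.indicator_of_mem (s := {ω | (openSubgraph (cycleGraph 5) ω).Adj i (i + 1)}) h _
  have hzero : ∀ i ω, ¬ (openSubgraph _ ω).Adj i (i + 1) → e i ω = 0 := fun i ω h =>
    Set.indicator_of_notMem (s := {ω | (openSubgraph (cycleGraph 5) ω).Adj i (i + 1)}) h _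
  have de : ∀ i, DependsOn (e i) (inside (cycleGraph 5) {i, i + 1}) := by
    intro i ω ω' h
    have : (openSubgraph _ ω).Adj i (i + 1) ↔ (openSubgraph _ ω').Adj i (i + 1) :=
      adj_congr h (by simp) (by simp)
    by_cases h1 : (openSubgraph _ ω).Adj i (i + 1)
    · rw [hone i ω h1, hone i ω' (this.1 h1)]
    · rw [hzero i ω h1, hzero i ω' fun h2 => h1 (this.2 h2)]
  have dh : ∀ i, DependsOn (fun ω => oppositeWeight p (e (i + 2) ω) (e (i + 3) ω))
      (inside (cycleGraph 5) {i + 2, i + 3, i + 4}) := by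
    intro i ω ω' h
    have h1 : e (i + 2) ω = e (i + 2) ω' := (de (i + 2)).mono (inside_mono (by
      rw [add_assoc]; rintro x (rfl | rfl) <;> simp)) h
    have h2 : e (i + 3) ω = e (i + 3) ω' := (de (i + 3)).mono (inside_mono (by
      rw [add_assoc]; rintro x (rfl | rfl) <;> simp)) h
    simp only [h1, h2]
  -- The edge `i` and the opposite path on `i + 2, i + 3, i + 4` share no vertex, so the expectation
  -- factors into two nonnegative terms.
  have hterm : ∀ i, 0 ≤ ∫ ω, (e i ω - p) * oppositeWeight p (e (i + 2) ω) (e (i + 3) ω) ∂μ := by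
    intro i
    have hd : Disjoint ({i, i + 1} : Set (Fin 5)) {i + 2, i + 3, i + 4} := by
      rw [Set.disjoint_left]
      simp only [Set.mem_insert_iff, Set.mem_singleton_iff]
      revert i
      decide
    rw [hμ.2.1.integral_mul (f := fun ω => e i ω - p) (Set.toFinite _) (Set.toFinite _) hd
      (fun ω ω' h => by simp only [de i h]) (dh i)]
    refine mul_nonneg ?_ (integral_nonneg fun ω =>
      oppositeWeight_nonneg hp' (by linarith) (he01 _ _) (he01 _ _))
    rw [integral_sub (integrable_univ _) (integrable_univ _)]
    simp only [integral_const, probReal_univ, one_smul, sub_nonneg]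
    exact le_integral_cycleEdge (n := 2) hμ i
  have hpt : ∀ ω, 5 * p * (3 * p ^ 2 - 1) +
      ∑ i, (e i ω - p) * oppositeWeight p (e (i + 2) ω) (e (i + 3) ω) ≤
      5 * (3 * p - 1) * c ω := by
    intro ω
    have := five_cycle_bound hp (cycleConn_nonneg (n := 2) ω) (he01 0 ω) (he01 1 ω) (he01 2 ω)
      (he01 3 ω) (he01 4 ω) ?_
    · rw [Fin.sum_univ_five]
      exact this
    · intro h4
      have h1 := sum_cycleEdge_le (n := 2) ω
      have h2 : ∑ i, cycleEdge (n := 2) i ω = e 0 ω + e 1 ω + e 2 ω + e 3 ω + e 4 ω :=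
        Fin.sum_univ_five _
      by_contra hne
      have h3 : c ω = 0 := Set.indicator_of_notMem (fun h => hne (Set.indicator_of_mem h _)) _
      have h4 : cycleConn (n := 2) ω = 0 := h3
      norm_num [h4] at h1
      linarith
  have h1 := integral_mono (μ := μ) (integrable_univ _) (integrable_univ _) hpt
  rw [integral_add (integrable_univ _) (integrable_univ _),
    integral_finsetSum _ fun i _ => integrable_univ _, integral_const_mul (5 * (3 * p - 1)) c, hc1] at h1
  simp only [integral_const, probReal_univ, one_smul] at h1
  have h2 := Finset.sum_nonneg (s := Finset.univ) fun i _ => hterm i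
  rw [div_le_iff₀ (by linarith)]
  linarith

end FiveCycle

theorem le_measureReal_path_two_preconnected {p : ℝ} {μ : Measure (Configuration (pathGraph 2))}
    (hμ : μ ∈ modelsGE 1 p (pathGraph 2)) :
    p ≤ μ.real {ω | (openSubgraph _ ω).Preconnected} := by
  have := hμ.1
  refine (le_measureReal_open hμ (u := 0) (v := 1) (by simp [pathGraph_adj])).trans
    (measureReal_mono ?_)
  intro ω (h : (openSubgraph _ ω).Adj 0 1) u v
  have := h.reachable
  have := this.symm
  fin_cases u <;> fin_cases v <;> first | assumption | exact Reachable.refl _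

end Cycle

/-! ### A second moment bound -/

section Concentration

/-- Chebyshev's inequality for a sum of variables most pairs of which are uncorrelated. -/
lemma measureReal_sum_le_of_uncorrelated {Ω ι : Type*} [MeasurableSpace Ω] {μ : Measure Ω}
    [IsProbabilityMeasure μ] [DecidableEq ι] (I : Finset ι) (X : ι → Ω → ℝ)
    (hm : ∀ i ∈ I, Measurable (X i)) (h0 : ∀ i ω, 0 ≤ X i ω) (h1 : ∀ i ω, X i ω ≤ 1) {p t : ℝ}
    (ht : 0 < t) (hp : ∀ i ∈ I, p ≤ ∫ ω, X i ω ∂μ) (R : Finset (ι × ι))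
    (hR : ∀ i ∈ I, ∀ j ∈ I, (i, j) ∉ R →
      ∫ ω, X i ω * X j ω ∂μ = (∫ ω, X i ω ∂μ) * ∫ ω, X j ω ∂μ) :
    μ.real {ω | ∑ i ∈ I, X i ω ≤ I.card * p - t} ≤ R.card / t ^ 2 := by
  set Y : ι → Ω → ℝ := fun i ω => X i ω - ∫ ω, X i ω ∂μ with hY
  have iX : ∀ i ∈ I, Integrable (X i) μ := fun i hi =>
    Integrable.of_bound (hm i hi).aestronglyMeasurable 1
      (Filter.Eventually.of_forall fun ω => by rw [Real.norm_of_nonneg (h0 i ω)]; exact h1 i ω)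
  have bI : ∀ i ∈ I, 0 ≤ ∫ ω, X i ω ∂μ ∧ ∫ ω, X i ω ∂μ ≤ 1 := by
    intro i hi
    refine ⟨integral_nonneg (h0 i), ?_⟩
    have := integral_mono (iX i hi) (integrable_const 1) (h1 i)
    simpa using this
  have bY : ∀ i ∈ I, ∀ j ∈ I, ∀ ω, |Y i ω * Y j ω| ≤ 1 := by
    intro i hi j hj ω
    have h2 : ∀ i ∈ I, |Y i ω| ≤ 1 := fun i hi => by
      rw [abs_le]
      constructor <;> simp only [hY] <;> linarith [h0 i ω, h1 i ω, (bI i hi).1, (bI i hi).2]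
    rw [abs_mul]
    exact mul_le_one₀ (h2 i hi) (abs_nonneg _) (h2 j hj)
  have mY : ∀ i ∈ I, Measurable (Y i) := fun i hi => (hm i hi).sub_const _
  have iY : ∀ i ∈ I, ∀ j ∈ I, Integrable (fun ω => Y i ω * Y j ω) μ := fun i hi j hj =>
    Integrable.of_bound ((mY i hi).mul (mY j hj)).aestronglyMeasurable 1
      (Filter.Eventually.of_forall fun ω => bY i hi j hj ω)
  have e0 : ∀ i ∈ I, ∀ j ∈ I, (i, j) ∉ R → ∫ ω, Y i ω * Y j ω ∂μ = 0 := by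
    intro i hi j hj hij
    have iXX : Integrable (fun ω => X i ω * X j ω) μ :=
      Integrable.of_bound ((hm i hi).mul (hm j hj)).aestronglyMeasurable 1
      (Filter.Eventually.of_forall fun ω => by
        rw [Real.norm_of_nonneg (mul_nonneg (h0 i ω) (h0 j ω))]
        exact mul_le_one₀ (h1 i ω) (h0 j ω) (h1 j ω))
    have : ∀ ω, Y i ω * Y j ω = X i ω * X j ω - (∫ ω, X j ω ∂μ) * X i ω -
        ((∫ ω, X i ω ∂μ) * X j ω - (∫ ω, X i ω ∂μ) * (∫ ω, X j ω ∂μ)) := by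
      intro ω; simp only [hY]; ring
    simp_rw [this]
    have i1 : Integrable (fun ω => (∫ ω, X j ω ∂μ) * X i ω) μ := (iX i hi).const_mul _
    have i2 : Integrable (fun ω => (∫ ω, X i ω ∂μ) * X j ω) μ := (iX j hj).const_mul _
    have i3 : Integrable (fun ω => X i ω * X j ω - (∫ ω, X j ω ∂μ) * X i ω) μ := iXX.sub i1
    have i4 : Integrable (fun ω => (∫ ω, X i ω ∂μ) * X j ω -
        (∫ ω, X i ω ∂μ) * (∫ ω, X j ω ∂μ)) μ := i2.sub (integrable_const _)
    rw [integral_sub i3 i4, integral_sub iXX i1,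
      integral_sub i2 (integrable_const _), integral_const_mul,
      integral_const_mul, hR i hi j hj hij]
    simp
    ring
  -- Expanding the square, pairs outside `R` contribute zero and each pair in `R` contributes at
  -- most one.
  have hvar : ∫ ω, (∑ i ∈ I, Y i ω) ^ 2 ∂μ ≤ R.card := by
    have : ∀ ω, (∑ i ∈ I, Y i ω) ^ 2 = ∑ q ∈ I ×ˢ I, Y q.1 ω * Y q.2 ω := by
      intro ω
      rw [sq, Finset.sum_mul_sum, Finset.sum_product]
    simp_rw [this]
    rw [integral_finsetSum _ fun q hq => iY _ (Finset.mem_product.1 hq).1 _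
      (Finset.mem_product.1 hq).2]
    calc ∑ q ∈ I ×ˢ I, ∫ ω, Y q.1 ω * Y q.2 ω ∂μ
        ≤ ∑ q ∈ I ×ˢ I, if q ∈ R then (1 : ℝ) else 0 := by
          refine Finset.sum_le_sum fun q hq => ?_
          obtain ⟨hq1, hq2⟩ := Finset.mem_product.1 hq
          split_ifs with h
          · have := integral_mono (iY _ hq1 _ hq2) (integrable_const (1 : ℝ))
              fun ω => (abs_le.1 (bY _ hq1 _ hq2 ω)).2
            simpa using this
          · exact (e0 _ hq1 _ hq2 h).le
      _ = ((I ×ˢ I).filter (· ∈ R)).card := by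
          rw [← Finset.sum_filter, Finset.sum_const, nsmul_eq_mul, mul_one]
      _ ≤ R.card := by
          exact_mod_cast Finset.card_le_card fun q hq => (Finset.mem_filter.1 hq).2
  have iS : Integrable (fun ω => (∑ i ∈ I, Y i ω) ^ 2) μ := by
    have : ∀ ω, (∑ i ∈ I, Y i ω) ^ 2 = ∑ q ∈ I ×ˢ I, Y q.1 ω * Y q.2 ω := by
      intro ω
      rw [sq, Finset.sum_mul_sum, Finset.sum_product]
    simp_rw [this]
    exact integrable_finsetSum _ fun q hq => iY _ (Finset.mem_product.1 hq).1 _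
      (Finset.mem_product.1 hq).2
  have hM := mul_meas_ge_le_integral_of_nonneg (μ := μ)
    (Filter.Eventually.of_forall fun ω => sq_nonneg (∑ i ∈ I, Y i ω)) iS (t ^ 2)
  have hsub : {ω | ∑ i ∈ I, X i ω ≤ I.card * p - t} ⊆ {ω | t ^ 2 ≤ (∑ i ∈ I, Y i ω) ^ 2} := by
    intro ω hω
    simp only [Set.mem_ofPred_eq] at hω ⊢
    have h2 : ∑ i ∈ I, Y i ω = ∑ i ∈ I, X i ω - ∑ i ∈ I, ∫ ω, X i ω ∂μ := by
      simp only [hY, Finset.sum_sub_distrib]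
    have h3 := Finset.card_nsmul_le_sum I (fun i => ∫ ω, X i ω ∂μ) p hp
    rw [nsmul_eq_mul] at h3
    rw [← neg_sq (∑ i ∈ I, Y i ω)]
    exact pow_le_pow_left₀ ht.le (by linarith) 2
  rw [le_div_iff₀ (by positivity), mul_comm]
  exact (mul_le_mul_of_nonneg_left (measureReal_mono hsub) (by positivity)).trans (hM.trans hvar)

end Concentration

/-! ### Large components in graphs of density above 5/9 -/

section LargeComponents

open scoped Classical in
/-- The number of ordered adjacent pairs with both entries in `B`. -/
noncomputable def pairCount {V : Type*} (H : SimpleGraph V) (B : Finset V) : ℕ :=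
  ((B ×ˢ B).filter fun q => H.Adj q.1 q.2).card

open scoped Classical in
/-- The vertices reachable from `v` in `B`. -/
noncomputable def reachIn {V : Type*} (H : SimpleGraph V) (B : Finset V) (v : V) : Finset V :=
  B.filter fun w => H.Reachable v w

open scoped Classical in
/-- The vertices whose component has more than half of all vertices. -/
noncomputable def bigSet {V : Type*} [Fintype V] (H : SimpleGraph V) : Finset V :=
  Finset.univ.filter fun v => Fintype.card V < 2 * (reachIn H Finset.univ v).card

variable {V : Type*} {H : SimpleGraph V} {B : Finset V}

lemma mem_reachIn {u v : V} : v ∈ reachIn H B u ↔ v ∈ B ∧ H.Reachable u v := by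
  simp [reachIn]

lemma reachIn_eq {u v : V} (h : H.Reachable u v) : reachIn H B u = reachIn H B v := by
  ext w
  rw [mem_reachIn, mem_reachIn]
  exact and_congr_right fun _ => ⟨fun h' => h.symm.trans h', fun h' => h.trans h'⟩

lemma pairCount_le_sum : pairCount H B ≤ ∑ v ∈ B, (reachIn H B v).card := by
  classical
  rw [pairCount, Finset.card_filter, Finset.sum_product]
  refine Finset.sum_le_sum fun v _ => ?_
  rw [← Finset.card_filter]
  refine Finset.card_le_card fun w hw => ?_
  rw [Finset.mem_filter] at hw
  exact mem_reachIn.2 ⟨hw.1, hw.2.reachable⟩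

/-- Adjacent pairs lie in a common component, so their number is at most the sum of the squared
component sizes. If no component exceeds half of `B`, this sum is at most `|B|² / 2`. Otherwise,
with one of size `m`, it is at most `m² + (|B| - m)²`, which for `|B| / 2 < m ≤ 2 * |B| / 3` does
not exceed `5 / 9 * |B|²`. -/
lemma exists_two_mul_card_lt_of_pairCount (h : 5 * B.card ^ 2 < 9 * pairCount H B) :
    ∃ v ∈ B, 2 * B.card < 3 * (reachIn H B v).card := by
  classical
  have h1 := pairCount_le_sum (H := H) (B := B)
  have hB : 0 < B.card := by
    rw [Finset.card_pos]
    rw [Finset.nonempty_iff_ne_empty]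
    rintro rfl
    simp [pairCount] at h
  obtain ⟨v, hv, hv2⟩ : ∃ v ∈ B, B.card < 2 * (reachIn H B v).card := by
    by_contra! hcon
    have h2 : 2 * ∑ v ∈ B, (reachIn H B v).card ≤ B.card * B.card := by
      rw [Finset.mul_sum]
      simpa using Finset.sum_le_card_nsmul B _ _ hcon
    nlinarith
  refine ⟨v, hv, ?_⟩
  set m := (reachIn H B v).card with hm
  have hmB : m ≤ B.card := Finset.card_le_card fun w hw => (mem_reachIn.1 hw).1
  have hsub : reachIn H B v ⊆ B := fun w hw => (mem_reachIn.1 hw).1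
  have h2 : ∑ w ∈ B, (reachIn H B w).card ≤ m * m + (B.card - m) * (B.card - m) := by
    rw [← Finset.sum_sdiff hsub, add_comm]
    refine add_le_add ?_ ?_
    · rw [Finset.sum_congr rfl fun w hw => by rw [← reachIn_eq (mem_reachIn.1 hw).2]]
      simp [hm]
    · have h3 : ∀ w ∈ B \ reachIn H B v, (reachIn H B w).card ≤ B.card - m := by
        intro w hw
        rw [hm, ← Finset.card_sdiff_of_subset hsub]
        refine Finset.card_le_card fun x hx => ?_
        rw [mem_reachIn] at hx
        rw [Finset.mem_sdiff] at hw ⊢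
        refine ⟨hx.1, fun hx' => hw.2 (mem_reachIn.2 ⟨hw.1, ?_⟩)⟩
        exact (mem_reachIn.1 hx').2.trans hx.2.symm
      have := Finset.sum_le_card_nsmul _ _ _ h3
      rwa [Finset.card_sdiff_of_subset hsub, smul_eq_mul] at this
  obtain ⟨r, hr⟩ := Nat.exists_eq_add_of_le hmB
  rw [hr] at h hv2 h2 ⊢
  rw [Nat.add_sub_cancel_left] at h2
  by_contra! hcon
  nlinarith

variable [Fintype V]

lemma mem_bigSet {v : V} :
    v ∈ bigSet H ↔ Fintype.card V < 2 * (reachIn H Finset.univ v).card := by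
  simp [bigSet]

lemma mem_bigSet_of_reachable {u v : V} (hu : u ∈ bigSet H) (h : H.Reachable u v) :
    v ∈ bigSet H := by
  rw [mem_bigSet] at hu ⊢
  rwa [← reachIn_eq h]

lemma exists_mem_inter_of_card_lt [DecidableEq V] {s t : Finset V}
    (h : Fintype.card V < s.card + t.card) :
    ∃ v, v ∈ s ∧ v ∈ t := by
  by_contra! hcon
  have : Disjoint s t := Finset.disjoint_left.2 hcon
  rw [← Finset.card_union_of_disjoint this] at h
  exact absurd (Finset.card_le_univ _) (not_le.2 h)

/-- Two components with more than half of the vertices intersect, so `bigSet` is a single component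
or empty. -/
lemma reachable_of_mem_bigSet {u v : V} (hu : u ∈ bigSet H) (hv : v ∈ bigSet H) :
    H.Reachable u v := by
  classical
  rw [mem_bigSet] at hu hv
  obtain ⟨w, h1, h2⟩ := exists_mem_inter_of_card_lt
    (s := reachIn H Finset.univ u) (t := reachIn H Finset.univ v) (by omega)
  exact (mem_reachIn.1 h1).2.trans (mem_reachIn.1 h2).2.symm

lemma two_mul_card_lt_card_bigSet
    (h : 5 * Fintype.card V ^ 2 < 9 * pairCount H Finset.univ) :
    2 * Fintype.card V < 3 * (bigSet H).card := by
  obtain ⟨v, -, hv⟩ := exists_two_mul_card_lt_of_pairCount (B := Finset.univ) h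
  rw [Finset.card_univ] at hv
  refine hv.trans_le (Nat.mul_le_mul_left 3 (Finset.card_le_card fun w hw => ?_))
  exact mem_bigSet_of_reachable (mem_bigSet.2 (by omega)) (mem_reachIn.1 hw).2

/-- Some component of `H` covers more than `4/9` of all vertices inside `B`. It is the big one, as
`4/9 + 2/3 > 1`, and its part in `B` meets `s`, as `4/9 + 5/9 = 1` and the first inequality is
strict. -/
lemma exists_mem_bigSet_of_pairCount (h : 5 * Fintype.card V ^ 2 < 9 * pairCount H Finset.univ)
    (hB : 2 * Fintype.card V < 3 * B.card) (hB' : 5 * B.card ^ 2 < 9 * pairCount H B)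
    {s : Finset V} (hs : 5 * Fintype.card V ≤ 9 * s.card) :
    ∃ v, v ∈ bigSet H ∧ v ∈ B ∧ v ∈ s := by
  classical
  have h1 := two_mul_card_lt_card_bigSet h
  obtain ⟨v, -, hv⟩ := exists_two_mul_card_lt_of_pairCount hB'
  obtain ⟨w, hw, hw'⟩ := exists_mem_inter_of_card_lt (s := bigSet H) (t := reachIn H B v) (by omega)
  obtain ⟨x, hx, hx'⟩ := exists_mem_inter_of_card_lt (s := s) (t := reachIn H B v) (by omega)
  refine ⟨x, mem_bigSet_of_reachable hw ?_, (mem_reachIn.1 hx').1, hx⟩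
  exact (mem_reachIn.1 hw').2.symm.trans (mem_reachIn.1 hx').2

end LargeComponents

/-! ### Chains of linked large components -/

section Linked

variable {V : Type*} [Fintype V] {G : SimpleGraph V}

/-- The large components of the levels `k` and `k + 1` are joined by an open edge. -/
def Linked (ω : Configuration (lineProd G)) (k : ℤ) : Prop :=
  ∃ v, v ∈ bigSet (slice ω k) ∧ v ∈ bigSet (slice ω (k + 1)) ∧ Rung ω k v

lemma linked_congr {a b : ℤ} {ω ω' : Configuration (lineProd G)}
    (h : ∀ e ∈ inside (lineProd G) (levels V a b), ω e = ω' e) {k : ℤ} (hk : a ≤ k ∧ k < b) :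
    Linked ω k ↔ Linked ω' k := by
  rw [Linked, Linked, slice_eq h ⟨hk.1, hk.2.le⟩, slice_eq h ⟨by omega, by omega⟩, rung_eq h hk]

theorem mem_longPathProbs_of_linked {p : ℝ} (hp : p ∈ Set.Icc (0 : ℝ) 1)
    (h : ∀ μ ∈ modelsGE 1 p (lineProd G), ∀ k : ℤ, μ.real {ω | ¬ Linked ω k} ≤ 1 / 4) :
    p ∈ longPathProbs (lineProd G) := by
  refine ⟨hp, fun μ hμ n => ?_⟩
  have := hμ.1
  set A : ℕ → Set (Configuration (lineProd G)) := fun k => {ω | ∀ i < k, Linked ω (i : ℕ)}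
  have dL : ∀ k : ℕ, DependsOn (· ∈ {ω : Configuration (lineProd G) | ¬ Linked ω k})
      (inside (lineProd G) (levels V k (k + 1))) := by
    intro k ω ω' h
    simp only [Set.mem_ofPred_eq, linked_congr h ⟨le_rfl, lt_add_one _⟩]
  -- Links `0, ..., k - 1` reach up to level `k`, so `A k` is independent of link `k + 1` but not of
  -- link `k`; hence again a two-step recursion.
  have dA : ∀ k : ℕ, DependsOn (· ∈ A k) (inside (lineProd G) (levels V 0 k)) := by
    intro k ω ω' h
    simp only [A, Set.mem_ofPred_eq, eq_iff_iff]
    refine forall_congr' fun i => forall_congr' fun hi => ?_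
    rw [linked_congr h ⟨by omega, by omega⟩]
  have hpos : ∀ k, 0 < μ.real (A k) := by
    refine pos_of_two_step_recursion (f := 1) (g := 1 / 4) one_pos (by norm_num) ?_ ?_ ?_
    · simp [A]
    · have h1 : A 1 = {ω | ¬ Linked ω (0 : ℕ)}ᶜ := by
        ext ω; simp [A]
      have h2 := h μ hμ (0 : ℕ)
      rw [h1, probReal_compl_eq_one_sub (measurableSet_of_dependsOn (finite_levels _ _) (dL 0))]
      linarith
    · intro k
      have h1 : A (k + 1) ⊆ A (k + 2) ∪ (A k ∩ {ω | ¬ Linked ω (k + 1 : ℕ)}) := by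
        intro ω h1
        by_cases h : Linked ω (k + 1 : ℕ)
        · left
          intro i hi
          rcases (by omega : i < k + 1 ∨ i = k + 1) with h | rfl
          · exact h1 i h
          · assumption
        · exact Or.inr ⟨fun i hi => h1 i (by omega), h⟩
      have h2 := (measureReal_mono h1).trans (measureReal_union_le (μ := μ) _ _)
      rw [levels_measureReal_inter hμ.2.1 (by omega) (dA k) (dL (k + 1))] at h2
      have h3 := mul_le_mul_of_nonneg_left (h μ hμ (k + 1 : ℕ)) (measureReal_nonneg (μ := μ) (s := A k))
      linarith
  have hsub : A (n + 1) ⊆ openPathEvent (lineProd G) n := by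
    intro ω h1
    obtain ⟨u, hu, -, -⟩ := h1 0 (by omega)
    have key : ∀ i : ℕ, i < n + 1 → ∀ v, v ∈ bigSet (slice ω i) →
        (openSubgraph (lineProd G) ω).Reachable ((0 : ℕ), u) ((i : ℤ), v) := by
      intro i
      induction i with
      | zero => exact fun hi v hv => reachable_of_slice (reachable_of_mem_bigSet hu hv)
      | succ i ih =>
        intro hi v hv
        obtain ⟨w, hw, hw', hr⟩ := h1 i (by omega)
        refine (ih (by omega) w hw).trans (hr.reachable.trans ?_)
        push_cast at hv ⊢
        exact reachable_of_slice (reachable_of_mem_bigSet hw' hv)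
    obtain ⟨v, hv, -, -⟩ := h1 n (by omega)
    exact mem_openPathEvent_of_reachable (key n (by omega) v hv) (by simp)
  refine lt_of_lt_of_le ?_ (measure_mono hsub)
  exact (ENNReal.toReal_pos_iff.1 (hpos (n + 1))).1

end Linked

/-! ### Complete graphs: links above 5/9 -/

section Complete

variable {V : Type*} {μ : Measure (Configuration (lineProd (⊤ : SimpleGraph V)))}

lemma measureReal_pairCount_le {ε : ℝ} (hε : 0 < ε) (hε' : ε ≤ 1)
    (hμ : μ ∈ modelsGE 1 (5 / 9 + ε) (lineProd (⊤ : SimpleGraph V))) (k : ℤ) (B : Finset V)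
    (hB : 256 ≤ ε ^ 2 * B.card) :
    μ.real {ω | 9 * pairCount (slice ω k) B ≤ 5 * B.card ^ 2} ≤ 1 / 16 := by
  classical
  have := hμ.1
  set b : ℝ := (B.card : ℝ) with hb
  set X : V × V → Configuration (lineProd (⊤ : SimpleGraph V)) → ℝ := fun q =>
    Set.indicator {ω | (openSubgraph _ ω).Adj (k, q.1) (k, q.2)} 1 with hX
  set S : V × V → Set (ℤ × V) := fun q => {(k, q.1), (k, q.2)}
  have dX : ∀ q, DependsOn (X q) (inside (lineProd ⊤) (S q)) := by
    intro q ω ω' h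
    have : (openSubgraph _ ω).Adj (k, q.1) (k, q.2) ↔ (openSubgraph _ ω').Adj (k, q.1) (k, q.2) :=
      adj_congr h (by simp [S]) (by simp [S])
    simp only [hX, Set.indicator, Set.mem_ofPred_eq, this]
    rfl
  set R : Finset ((V × V) × (V × V)) := (B.offDiag ×ˢ B.offDiag).filter fun q =>
    ¬ Disjoint (S q.1) (S q.2) with hR
  -- The shared vertex is the first or second entry of either pair: four patterns with three free
  -- vertices each.
  have hRcard : R.card ≤ 4 * B.card ^ 3 := by
    have h1 : R ⊆ ((B ×ˢ B ×ˢ B).image fun t => ((t.1, t.2.1), (t.1, t.2.2))) ∪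
        ((B ×ˢ B ×ˢ B).image fun t => ((t.1, t.2.1), (t.2.2, t.1))) ∪
        ((B ×ˢ B ×ˢ B).image fun t => ((t.2.1, t.1), (t.1, t.2.2))) ∪
        ((B ×ˢ B ×ˢ B).image fun t => ((t.2.1, t.1), (t.2.2, t.1))) := by
      rintro ⟨⟨a, b⟩, c, d⟩ h
      simp only [hR, S, Finset.mem_filter, Finset.mem_product, Finset.mem_offDiag,
        Set.not_disjoint_iff, Set.mem_insert_iff, Set.mem_singleton_iff] at h
      obtain ⟨⟨⟨ha, hb, -⟩, hc, hd, -⟩, x, h1, h2⟩ := h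
      simp only [Finset.mem_union, Finset.mem_image, Finset.mem_product, Prod.exists,
        Prod.mk.injEq]
      rcases h1 with rfl | rfl <;> rcases h2 with h2 | h2 <;>
        simp only [Prod.mk.injEq, true_and] at h2 <;> subst h2
      · exact Or.inl (Or.inl (Or.inl ⟨_, _, _, ⟨ha, hb, hd⟩, ⟨rfl, rfl⟩, rfl, rfl⟩))
      · exact Or.inl (Or.inl (Or.inr ⟨_, _, _, ⟨ha, hb, hc⟩, ⟨rfl, rfl⟩, rfl, rfl⟩))
      · exact Or.inl (Or.inr ⟨_, _, _, ⟨hb, ha, hd⟩, ⟨rfl, rfl⟩, rfl, rfl⟩)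
      · exact Or.inr ⟨_, _, _, ⟨hb, ha, hc⟩, ⟨rfl, rfl⟩, rfl, rfl⟩
    have h2 : (B ×ˢ B ×ˢ B).card = B.card ^ 3 := by
      rw [Finset.card_product, Finset.card_product]; ring
    refine (Finset.card_le_card h1).trans ?_
    refine (Finset.card_union_le _ _).trans ?_
    refine (add_le_add_left ((Finset.card_union_le _ _).trans
      (add_le_add_left (Finset.card_union_le _ _) _)) _).trans ?_
    have h3 : ∀ f : V × V × V → (V × V) × (V × V), ((B ×ˢ B ×ˢ B).image f).card ≤ B.card ^ 3 :=
      fun f => Finset.card_image_le.trans h2.le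
    have h4 := h3 fun t => ((t.1, t.2.1), (t.1, t.2.2))
    have h5 := h3 fun t => ((t.1, t.2.1), (t.2.2, t.1))
    have h6 := h3 fun t => ((t.2.1, t.1), (t.1, t.2.2))
    have h7 := h3 fun t => ((t.2.1, t.1), (t.2.2, t.1))
    linarith
  have hb1 : 256 ≤ ε * b := hB.trans (by
    rw [sq, mul_assoc]
    exact mul_le_of_le_one_left (by positivity) hε')
  have hb0 : 0 < b := by
    by_contra! hneg
    nlinarith
  have hI : (B.offDiag.card : ℝ) = b ^ 2 - b := by
    rw [Finset.offDiag_card, Nat.cast_sub (Nat.le_mul_self _)]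
    push_cast
    ring
  -- This deviation puts the Chebyshev threshold exactly at `5 / 9 * b ^ 2`. As `t ≥ ε / 2 * b ^ 2`,
  -- the bound is at most `4 * b ^ 3 / t ^ 2 ≤ 16 / (ε ^ 2 * b) ≤ 1 / 16`.
  set t : ℝ := B.offDiag.card * (5 / 9 + ε) - 5 / 9 * b ^ 2 with ht
  have ht1 : ε / 2 * b ^ 2 ≤ t := by
    rw [ht, hI]
    nlinarith
  have ht0 : 0 < t := lt_of_lt_of_le (by positivity) ht1
  have key := measureReal_sum_le_of_uncorrelated (μ := μ) B.offDiag X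
    (fun q _ => measurable_of_dependsOn (Set.toFinite _) (dX q))
    (fun q ω => Set.indicator_nonneg (fun _ _ => zero_le_one) _)
    (fun q ω => Set.indicator_le_self' (fun _ _ => zero_le_one) ω) ht0 (p := 5 / 9 + ε) ?_ R ?_
  · refine ((measureReal_mono ?_).trans key).trans ?_
    · intro ω hω
      simp only [Set.mem_ofPred_eq] at hω ⊢
      rw [ht]
      have h1 : ∑ q ∈ B.offDiag, X q ω ≤ pairCount (slice ω k) B := by
        rw [pairCount]
        simp only [hX, Set.indicator, Set.mem_ofPred_eq, Pi.one_apply]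
        rw [← Finset.sum_filter, Finset.sum_const, nsmul_eq_mul, mul_one, Nat.cast_le]
        refine Finset.card_le_card fun q hq => ?_
        rw [Finset.mem_filter, Finset.mem_offDiag] at hq
        rw [Finset.mem_filter, Finset.mem_product]
        exact ⟨⟨hq.1.1, hq.1.2.1⟩, slice_adj.2 hq.2⟩
      have h2 : (9 * pairCount (slice ω k) B : ℝ) ≤ 5 * b ^ 2 := by rw [hb]; exact_mod_cast hω
      linarith
    · rw [div_le_iff₀ (by positivity)]
      have h1 : (R.card : ℝ) ≤ 4 * b ^ 3 := by rw [hb]; exact_mod_cast hRcard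
      have h2 : (ε / 2 * b ^ 2) ^ 2 ≤ t ^ 2 := pow_le_pow_left₀ (by positivity) ht1 2
      have h3 : 256 * b ^ 3 ≤ ε ^ 2 * b * b ^ 3 := by gcongr
      nlinarith
  · intro q hq
    rw [Finset.mem_offDiag] at hq
    rw [hX, integral_indicator_one]
    · exact le_measureReal_open hμ (lineProd_adj.2 (Or.inr ⟨hq.2.2, rfl⟩))
    · refine measurableSet_of_dependsOn (Set.toFinite (S q)) fun ω ω' h => ?_
      simp only [Set.mem_ofPred_eq, eq_iff_iff]
      exact adj_congr h (by simp [S]) (by simp [S])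
  · intro q hq r hr hqr
    have hd : Disjoint (S q) (S r) := by
      by_contra hd
      exact hqr (Finset.mem_filter.2 ⟨Finset.mem_product.2 ⟨hq, hr⟩, hd⟩)
    exact hμ.2.1.integral_mul (Set.toFinite _) (Set.toFinite _) hd (dX q) (dX r)

variable [Fintype V]

open scoped Classical in
lemma measureReal_card_rung_lt {ε : ℝ} (hε : 0 < ε) {G : SimpleGraph V}
    {μ : Measure (Configuration (lineProd G))}
    (hμ : μ ∈ modelsGE 1 (5 / 9 + ε) (lineProd G)) (k : ℤ)
    (hV : 16 ≤ ε ^ 2 * Fintype.card V) :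
    μ.real {ω | 9 * (Finset.univ.filter fun v => Rung ω k v).card < 5 * Fintype.card V} ≤
      1 / 16 := by
  have := hμ.1
  set b : ℝ := (Fintype.card V : ℝ) with hb
  set X : V → Configuration (lineProd G) → ℝ := fun v =>
    Set.indicator {ω | (openSubgraph _ ω).Adj (k, v) (k + 1, v)} 1 with hX
  set S : V → Set (ℤ × V) := fun v => {(k, v), (k + 1, v)}
  have dX : ∀ q, DependsOn (X q) (inside (lineProd G) (S q)) := by
    intro q ω ω' h
    have : (openSubgraph _ ω).Adj (k, q) (k + 1, q) ↔ (openSubgraph _ ω').Adj (k, q) (k + 1, q) :=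
      adj_congr h (by simp [S]) (by simp [S])
    simp only [hX, Set.indicator, Set.mem_ofPred_eq, this]
    rfl
  have hb0 : 0 < b := by
    by_contra! hneg
    nlinarith [sq_nonneg ε]
  have ht0 : 0 < ε * b := by positivity
  have key := measureReal_sum_le_of_uncorrelated (μ := μ) Finset.univ X
    (fun q _ => measurable_of_dependsOn (Set.toFinite _) (dX q))
    (fun q ω => Set.indicator_nonneg (fun _ _ => zero_le_one) _)
    (fun q ω => Set.indicator_le_self' (fun _ _ => zero_le_one) ω) ht0 (p := 5 / 9 + ε) ?_
    (Finset.univ.image fun v => (v, v)) ?_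
  · refine ((measureReal_mono ?_).trans key).trans ?_
    · intro ω hω
      simp only [Set.mem_ofPred_eq] at hω ⊢
      have h1 : ∑ q, X q ω = (Finset.univ.filter fun v => Rung ω k v).card := by
        simp only [hX, Set.indicator, Set.mem_ofPred_eq, Pi.one_apply]
        rw [← Finset.sum_filter, Finset.sum_const, nsmul_eq_mul, mul_one]
        rfl
      have h2 : (9 * (Finset.univ.filter fun v => Rung ω k v).card : ℝ) < 5 * b := by
        rw [hb]
        exact_mod_cast hω
      rw [h1, Finset.card_univ]
      linarith
    · rw [div_le_iff₀ (by positivity)]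
      have h1 : ((Finset.univ.image fun v : V => (v, v)).card : ℝ) ≤ b := by
        rw [hb, ← Finset.card_univ]
        exact_mod_cast Finset.card_image_le
      have h3 : 16 * b ≤ ε ^ 2 * b * b := by gcongr
      nlinarith
  · intro q hq
    rw [hX, integral_indicator_one]
    · exact le_measureReal_open hμ (lineProd_adj.2 (Or.inl ⟨Or.inl rfl, rfl⟩))
    · refine measurableSet_of_dependsOn (Set.toFinite (S q)) fun ω ω' h => ?_
      simp only [Set.mem_ofPred_eq, eq_iff_iff]
      exact adj_congr h (by simp [S]) (by simp [S])
  · intro q hq r hr hqr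
    have hne : q ≠ r := by
      rintro rfl
      exact hqr (Finset.mem_image_of_mem _ (Finset.mem_univ _))
    have hd : Disjoint (S q) (S r) := by
      rw [Set.disjoint_left]
      rintro x (rfl | rfl) (h | h) <;> exact hne (Prod.ext_iff.1 h).2
    exact hμ.2.1.integral_mul (Set.toFinite _) (Set.toFinite _) hd (dX q) (dX r)

/-- The random set `bigSet` of level `k + 1` is independent of level `k`, so one may sum over its
values `B` and use the bound for fixed `B`. The constant 512 leaves at least 256 after the factor
`2/3`. -/
lemma measureReal_pairCount_bigSet_le {ε : ℝ} (hε : 0 < ε) (hε' : ε ≤ 1)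
    (hμ : μ ∈ modelsGE 1 (5 / 9 + ε) (lineProd (⊤ : SimpleGraph V))) (k : ℤ)
    (hV : 512 ≤ ε ^ 2 * Fintype.card V) :
    μ.real {ω | 2 * Fintype.card V < 3 * (bigSet (slice ω (k + 1))).card ∧
      9 * pairCount (slice ω k) (bigSet (slice ω (k + 1))) ≤
        5 * (bigSet (slice ω (k + 1))).card ^ 2} ≤ 1 / 16 := by
  classical
  have := hμ.1
  set D : Finset V → Set (Configuration (lineProd (⊤ : SimpleGraph V))) := fun B =>
    {ω | bigSet (slice ω (k + 1)) = B}
  set E : Finset V → Set (Configuration (lineProd (⊤ : SimpleGraph V))) := fun B =>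
    {ω | 2 * Fintype.card V < 3 * B.card ∧ 9 * pairCount (slice ω k) B ≤ 5 * B.card ^ 2}
  have dD : ∀ B, DependsOn (· ∈ D B) (inside _ (levels V (k + 1) (k + 1))) := by
    intro B ω ω' h
    simp only [D, Set.mem_ofPred_eq, slice_eq h ⟨le_rfl, le_rfl⟩]
  have dE : ∀ B, DependsOn (· ∈ E B) (inside _ (levels V k k)) := by
    intro B ω ω' h
    simp only [E, Set.mem_ofPred_eq, slice_eq h ⟨le_rfl, le_rfl⟩]
  have hE : ∀ B, μ.real (E B) ≤ 1 / 16 := by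
    intro B
    by_cases hB : 2 * Fintype.card V < 3 * B.card
    · refine (measureReal_mono fun ω hω => hω.2).trans (measureReal_pairCount_le hε hε' hμ k B ?_)
      have h1 : (2 * Fintype.card V : ℝ) ≤ 3 * B.card := by exact_mod_cast hB.le
      nlinarith [sq_nonneg ε]
    · have : E B = ∅ := by
        ext ω; simp [E, hB]
      rw [this]
      norm_num
  have hsum : ∑ B, μ.real (D B) = 1 := by
    rw [← measureReal_biUnion_finset]
    · have : ⋃ B ∈ (Finset.univ : Finset (Finset V)), D B = Set.univ := by
        ext ω; simp [D]
      rw [this, probReal_univ]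
    · intro B _ B' _ hne
      rw [Function.onFun, Set.disjoint_left]
      intro ω (h1 : _ = _) (h2 : _ = _)
      exact hne (h1.symm.trans h2)
    · exact fun B _ => measurableSet_of_dependsOn (finite_levels _ _) (dD B)
  calc μ.real _ ≤ μ.real (⋃ B ∈ (Finset.univ : Finset (Finset V)), (E B ∩ D B)) := by
        refine measureReal_mono (fun ω hω => ?_) (measure_ne_top _ _)
        simp only [Finset.mem_univ, Set.iUnion_true, Set.mem_iUnion]
        exact ⟨_, hω, rfl⟩
    _ ≤ ∑ B, μ.real (E B ∩ D B) := measureReal_biUnion_finset_le _ _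
    _ ≤ ∑ B, 1 / 16 * μ.real (D B) := by
        refine Finset.sum_le_sum fun B _ => ?_
        rw [levels_measureReal_inter hμ.2.1 (by omega) (dE B) (dD B)]
        exact mul_le_mul_of_nonneg_right (hE B) measureReal_nonneg
    _ = 1 / 16 := by rw [← Finset.mul_sum, hsum, mul_one]

theorem measureReal_not_linked_le {ε : ℝ} (hε : 0 < ε) (hε' : ε ≤ 1)
    (hμ : μ ∈ modelsGE 1 (5 / 9 + ε) (lineProd (⊤ : SimpleGraph V))) (k : ℤ)
    (hV : 512 ≤ ε ^ 2 * Fintype.card V) : μ.real {ω | ¬ Linked ω k} ≤ 1 / 4 := by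
  classical
  have := hμ.1
  have hV' : 256 ≤ ε ^ 2 * (Finset.univ : Finset V).card := by
    rw [Finset.card_univ]; linarith
  have h1 := measureReal_pairCount_le hε hε' hμ k Finset.univ hV'
  have h2 := measureReal_pairCount_le hε hε' hμ (k + 1) Finset.univ hV'
  have h3 := measureReal_pairCount_bigSet_le hε hε' hμ k hV
  have h4 := measureReal_card_rung_lt hε hμ k (by linarith)
  refine (measureReal_mono (?_ : _ ⊆ (({ω | _} ∪ {ω | _}) ∪ {ω | _}) ∪ {ω | _})).trans
    (((measureReal_union_le _ _).trans (add_le_add ((measureReal_union_le _ _).trans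
      (add_le_add ((measureReal_union_le _ _).trans (add_le_add h1 h2)) h3)) h4)).trans
      (by norm_num))
  intro ω hω
  by_contra hcon
  simp only [Set.mem_union, Set.mem_ofPred_eq, not_or, not_and, not_le, not_lt] at hcon
  obtain ⟨⟨⟨g1, g2⟩, g3⟩, g4⟩ := hcon
  have g5 := two_mul_card_lt_card_bigSet g2
  obtain ⟨v, hv1, hv2, hv3⟩ := exists_mem_bigSet_of_pairCount g1 g5 (g3 g5) g4
  exact hω ⟨v, hv1, hv2, (Finset.mem_filter.1 hv3).2⟩

theorem mem_longPathProbs_complete {ε : ℝ} (hε : 0 < ε) (hε' : 5 / 9 + ε ≤ 1)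
    (hV : 512 ≤ ε ^ 2 * Fintype.card V) :
    5 / 9 + ε ∈ longPathProbs (lineProd (⊤ : SimpleGraph V)) :=
  mem_longPathProbs_of_linked ⟨by linarith, hε'⟩ fun _ hμ k =>
    measureReal_not_linked_le hε (by linarith) hμ k hV

end Complete

/-! ### Independent coins -/

section Coins

/-- A coin showing `true` with probability `θ`. -/
noncomputable def coin (θ : ℝ) : Measure Bool :=
  ENNReal.ofReal θ • Measure.dirac true + ENNReal.ofReal (1 - θ) • Measure.dirac false

lemma isProbabilityMeasure_coin {θ : ℝ} (h : θ ∈ Set.Icc (0 : ℝ) 1) :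
    IsProbabilityMeasure (coin θ) := by
  constructor
  simp only [coin, Measure.coe_add, Measure.coe_smul, Pi.add_apply, Pi.smul_apply, measure_univ,
    smul_eq_mul, mul_one]
  rw [← ENNReal.ofReal_add h.1 (by linarith [h.2])]
  simp

lemma coin_real_true {θ : ℝ} (h : 0 ≤ θ) : (coin θ).real {true} = θ := by
  simp [coin, measureReal_def, h]

lemma coin_real_false {θ : ℝ} (h : θ ≤ 1) : (coin θ).real {false} = 1 - θ := by
  simp [coin, measureReal_def, h]

variable {ι : Type*} (θ : ι → ℝ)

/-- Independent coins. -/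
noncomputable def coins : Measure (ι → Bool) := Measure.infinitePi fun i => coin (θ i)

variable {θ} (hθ : ∀ i, θ i ∈ Set.Icc (0 : ℝ) 1)
include hθ

lemma isProbabilityMeasure_coins : IsProbabilityMeasure (coins θ) := by
  have := fun i => isProbabilityMeasure_coin (hθ i)
  unfold coins
  infer_instance

lemma coins_real_pair {i j : ι} (hij : i ≠ j) (a b : Bool) :
    (coins θ).real {σ | σ i = a ∧ σ j = b} = (coin (θ i)).real {a} * (coin (θ j)).real {b} := by
  have := fun i => isProbabilityMeasure_coin (hθ i)
  have h := Measure.infinitePi_map_eval_prod (P := fun i => coin (θ i)) hij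
  have h2 : coins θ {σ | σ i = a ∧ σ j = b} = ((coin (θ i)).prod (coin (θ j))) ({a} ×ˢ {b}) := by
    rw [← h, Measure.map_apply (by fun_prop)
      ((MeasurableSet.singleton a).prod (MeasurableSet.singleton b))]
    rfl
  rw [measureReal_def, h2, Measure.prod_prod, ENNReal.toReal_mul]
  rfl

lemma coins_real_true (i : ι) : (coins θ).real {σ | σ i = true} = θ i := by
  have := fun i => isProbabilityMeasure_coin (hθ i)
  rw [← coin_real_true (hθ i).1, ← Measure.infinitePi_map_eval (fun i => coin (θ i)) i,
    map_measureReal_apply (measurable_pi_apply i) (MeasurableSet.singleton _)]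
  rfl

lemma coins_real_eq {i j : ι} (hij : i ≠ j) :
    (coins θ).real {σ | σ i = σ j} = θ i * θ j + (1 - θ i) * (1 - θ j) := by
  have := isProbabilityMeasure_coins hθ
  have h : {σ : ι → Bool | σ i = σ j} =
      {σ | σ i = true ∧ σ j = true} ∪ {σ | σ i = false ∧ σ j = false} := by
    ext σ
    simp only [Set.mem_ofPred_eq, Set.mem_union]
    cases σ i <;> cases σ j <;> simp
  have hm : MeasurableSet {σ : ι → Bool | σ i = false ∧ σ j = false} := by
    measurability
  rw [h, measureReal_union _ hm, coins_real_pair hθ hij, coins_real_pair hθ hij,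
    coin_real_true (hθ i).1, coin_real_true (hθ j).1, coin_real_false (hθ i).2,
    coin_real_false (hθ j).2]
  rw [Set.disjoint_left]
  rintro σ ⟨h1, -⟩ ⟨h2, -⟩
  rw [h1] at h2
  cases h2

lemma coins_real_not_and {i j : ι} (hij : i ≠ j) :
    (coins θ).real {σ | ¬ (σ i = true ∧ σ j = true)} = 1 - θ i * θ j := by
  have := isProbabilityMeasure_coins hθ
  have hm : MeasurableSet {σ : ι → Bool | σ i = true ∧ σ j = true} := by
    measurability
  have := probReal_compl_eq_one_sub (μ := coins θ) hm
  rw [coins_real_pair hθ hij, coin_real_true (hθ i).1, coin_real_true (hθ j).1] at this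
  exact this

/-- Dependence on coordinates is expressed by σ-algebras because `S` and `T` may be infinite, as the
edge sets in 1-independence may be. -/
lemma indepFun_coins {S T : Set ι} (hST : Disjoint S T) {α β : Type*} [MeasurableSpace α]
    [MeasurableSpace β] {f : (ι → Bool) → α} {g : (ι → Bool) → β}
    (hf : Measurable[⨆ i ∈ S, MeasurableSpace.comap (fun σ : ι → Bool => σ i) inferInstance] f)
    (hg : Measurable[⨆ i ∈ T, MeasurableSpace.comap (fun σ : ι → Bool => σ i) inferInstance] g) :
    IndepFun f g (coins θ) := by
  have := fun i => isProbabilityMeasure_coin (hθ i)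
  have h1 : iIndepFun (fun i (σ : ι → Bool) => σ i) (coins θ) :=
    iIndepFun_infinitePi (P := fun i => coin (θ i)) (X := fun _ x => x) fun _ => measurable_id
  rw [iIndepFun_iff_iIndep] at h1
  have h2 := indep_iSup_of_disjoint (fun i => (measurable_pi_apply i).comap_le) h1 hST
  rw [IndepFun_iff_Indep]
  exact indep_of_indep_of_le_left (indep_of_indep_of_le_right h2 hg.comap_le) hf.comap_le

end Coins

/-! ### Models in which an edge is determined by the states of its endpoints -/

section VertexModels

variable {V : Type*} {G : SimpleGraph V} (D : V → V → Bool → Bool → Prop)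

open scoped Classical in
/-- The configuration in which the edge from `x` to `y` is open if the states of `x` and `y` are
related by `D x y` in one of the two orders. -/
noncomputable def vertexConfig (G : SimpleGraph V) (σ : V → Bool) : Configuration G :=
  fun e => decide (∃ x y, (e : Sym2 V) = s(x, y) ∧ D x y (σ x) (σ y))

lemma vertexConfig_eq_true {σ : V → Bool} {x y : V} (h : G.Adj x y) :
    vertexConfig D G σ ⟨s(x, y), h⟩ = true ↔ D x y (σ x) (σ y) ∨ D y x (σ y) (σ x) := by
  simp only [vertexConfig, decide_eq_true_eq]
  constructor
  · rintro ⟨a, b, h1, h2⟩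
    rcases Sym2.eq_iff.1 h1 with ⟨rfl, rfl⟩ | ⟨rfl, rfl⟩
    · exact Or.inl h2
    · exact Or.inr h2
  · rintro (h | h)
    · exact ⟨_, _, rfl, h⟩
    · exact ⟨_, _, Sym2.eq_swap, h⟩

lemma measurable_vertexConfig_apply {m : MeasurableSpace (V → Bool)} (e : G.edgeSet)
    (h : ∀ x ∈ (e : Sym2 V), Measurable[m] fun σ : V → Bool => σ x) :
    Measurable[m] fun σ => vertexConfig D G σ e := by
  classical
  obtain ⟨e, he⟩ := e
  induction e using Sym2.ind with
  | _ x y =>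
    have : (fun σ => vertexConfig D G σ ⟨s(x, y), he⟩) =
        (fun q : Bool × Bool => decide (D x y q.1 q.2 ∨ D y x q.2 q.1)) ∘
          fun σ : V → Bool => (σ x, σ y) := by
      funext σ
      rw [Bool.eq_iff_iff]
      exact (vertexConfig_eq_true D he).trans (by simp)
    rw [this]
    exact (measurable_of_finite _).comp ((h x (by simp)).prodMk (h y (by simp)))

lemma measurable_vertexConfig : Measurable (vertexConfig D G) :=
  measurable_pi_lambda _ fun e => measurable_vertexConfig_apply D e fun _ _ =>
    measurable_pi_apply _

variable {θ : V → ℝ} (hθ : ∀ i, θ i ∈ Set.Icc (0 : ℝ) 1)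
include hθ

lemma kIndependent_vertexConfig : KIndependent G 1 ((coins θ).map (vertexConfig D G)) := by
  intro F₁ F₂ hF
  rw [kDistant_one_iff] at hF
  set S : Set G.edgeSet → Set V := fun F => {v | ∃ e ∈ F, v ∈ (e : Sym2 V)}
  have hS : Disjoint (S F₁) (S F₂) := by
    rw [Set.disjoint_left]
    rintro v ⟨e, he, hv⟩ ⟨f, hf, hv'⟩
    exact hF e he f hf v hv hv'
  have hm : ∀ F : Set G.edgeSet, Measurable[⨆ i ∈ S F,
      MeasurableSpace.comap (fun σ : V → Bool => σ i) inferInstance]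
      fun σ (e : F) => vertexConfig D G σ e := by
    intro F
    refine @measurable_pi_lambda _ _ _ (_) _ _ fun e => ?_
    refine measurable_vertexConfig_apply D (e : G.edgeSet) fun x hx => ?_
    exact (comap_measurable fun σ : V → Bool => σ x).mono
      (le_iSup₂_of_le x ⟨e, e.2, hx⟩ le_rfl) le_rfl
  have key := indepFun_coins hθ hS (hm F₁) (hm F₂)
  have hr : ∀ F : Set G.edgeSet, Measurable fun (ω : Configuration G) (e : F) => ω e :=
    fun F => measurable_pi_lambda _ fun e => measurable_pi_apply _
  rw [indepFun_iff_measure_inter_preimage_eq_mul] at key ⊢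
  intro s t hs ht
  have h1 := key s t hs ht
  rw [Measure.map_apply (measurable_vertexConfig D) ((hr F₁ hs).inter (hr F₂ ht)),
    Measure.map_apply (measurable_vertexConfig D) (hr F₁ hs),
    Measure.map_apply (measurable_vertexConfig D) (hr F₂ ht)]
  exact h1

lemma vertexConfig_mem_modelsGE {p : ℝ}
    (h : ∀ x y, G.Adj x y → p ≤ (coins θ).real {σ | D x y (σ x) (σ y)} ∨
      p ≤ (coins θ).real {σ | D y x (σ y) (σ x)}) :
    (coins θ).map (vertexConfig D G) ∈ modelsGE 1 p G := by
  have := isProbabilityMeasure_coins hθ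
  refine ⟨Measure.isProbabilityMeasure_map (measurable_vertexConfig D).aemeasurable,
    kIndependent_vertexConfig D hθ, le_iInf ?_⟩
  rintro ⟨e, he⟩
  induction e using Sym2.ind with
  | _ x y =>
    rw [Measure.map_apply (measurable_vertexConfig D)
      (measurableSet_eq_fun (measurable_pi_apply _) measurable_const),
      ENNReal.ofReal_le_iff_le_toReal (measure_ne_top _ _), ← measureReal_def]
    rcases h x y he with h | h
    · exact h.trans (measureReal_mono fun σ hσ => (vertexConfig_eq_true D he).2 (Or.inl hσ))
    · exact h.trans (measureReal_mono fun σ hσ => (vertexConfig_eq_true D he).2 (Or.inr hσ))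

end VertexModels

/-! ### The barrier model and the lower bound -/

section Barrier

variable {V : Type*} {G : SimpleGraph V}

/-- The probabilities of the state `true` in the barrier model. -/
noncomputable def barrierProb (x : ℤ × V) : ℝ :=
  if x.1 % 3 = 1 then (3 - √3) / 2 else √3 - 1

/-- The states for which the edge from `x` to `y` is open in the barrier model. -/
def barrierRel (x y : ℤ × V) (a b : Bool) : Prop :=
  (y.1 = x.1 ∧ (x.1 % 3 = 0 ∨ x.1 % 3 = 1 ∧ a = b ∨ x.1 % 3 = 2 ∧ a = true ∧ b = true)) ∨
  (y.1 = x.1 + 1 ∧ x.2 = y.2 ∧ (x.1 % 3 = 0 ∧ b = true ∨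
    x.1 % 3 = 1 ∧ ¬ (a = true ∧ b = true) ∨ x.1 % 3 = 2 ∧ a = true))

/-- The index of the cell of a vertex: open edges of the barrier model stay within cells. -/
def barrierCell (σ : ℤ × V → Bool) (x : ℤ × V) : ℤ :=
  if x.1 % 3 = 0 ∨ x.1 % 3 = 1 ∧ σ x = true ∨
    x.1 % 3 = 2 ∧ σ x = false ∧ σ (x.1 - 1, x.2) = true then x.1 / 3 else x.1 / 3 + 1

/-- Levels `0` mod 3 are the cores of the cells. At level `1` mod 3 state `true` belongs to the core
below and `false` to the one above. At level `2` mod 3 state `true` belongs to the core above, while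
`false` follows the vertex underneath. The only conflict on a rung between these two levels is
`true` below `true`, which is closed. -/
lemma barrierCell_eq_of_rel {σ : ℤ × V → Bool} {x y : ℤ × V} (h : barrierRel x y (σ x) (σ y)) :
    barrierCell σ x = barrierCell σ y := by
  obtain ⟨k, v⟩ := x
  obtain ⟨l, w⟩ := y
  simp only [barrierRel] at h
  rcases h with ⟨rfl, h⟩ | ⟨rfl, rfl, h⟩
  · rcases h with h | ⟨h, h'⟩ | ⟨h, h', h''⟩ <;> simp [barrierCell, *]
  · have e : k + 1 - 1 = k := by ring
    rcases h with ⟨h, h'⟩ | ⟨h, h'⟩ | ⟨h, h'⟩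
    · have h1 : (k + 1) % 3 = 1 := by omega
      have h2 : (k + 1) / 3 = k / 3 := by omega
      simp [barrierCell, *]
    · have h1 : (k + 1) % 3 = 2 := by omega
      have h2 : (k + 1) / 3 = k / 3 := by omega
      simp only [barrierCell, h, h1, h2, e]
      cases h3 : σ (k, v) <;> cases h4 : σ (k + 1, v) <;> simp_all
    · have h1 : (k + 1) % 3 = 0 := by omega
      have h2 : (k + 1) / 3 = k / 3 + 1 := by omega
      simp [barrierCell, *]

lemma barrierCell_bounds (σ : ℤ × V → Bool) (x : ℤ × V) :
    3 * barrierCell σ x - 2 ≤ x.1 ∧ x.1 ≤ 3 * barrierCell σ x + 2 := by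
  unfold barrierCell
  split_ifs <;> omega

lemma barrierCell_eq_of_walk {σ : ℤ × V → Bool} {x y : ℤ × V}
    (w : (openSubgraph _ (vertexConfig barrierRel (lineProd G) σ)).Walk x y) :
    ∀ z ∈ w.support, barrierCell σ z = barrierCell σ x := by
  induction w with
  | nil => simp
  | cons h w ih =>
    obtain ⟨h1, h2⟩ := openSubgraph_adj.1 h
    intro z hz
    rw [SimpleGraph.Walk.support_cons, List.mem_cons] at hz
    rcases hz with rfl | hz
    · rfl
    · rw [ih z hz]
      rcases (vertexConfig_eq_true barrierRel h1).1 h2 with h3 | h3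
      · exact (barrierCell_eq_of_rel h3).symm
      · exact barrierCell_eq_of_rel h3

/-- An open path stays in one cell, which has at most five levels, whereas `5 * |V|` edges need one
vertex more than these contain. -/
lemma vertexConfig_notMem_openPathEvent [Fintype V] (σ : ℤ × V → Bool) :
    vertexConfig barrierRel (lineProd G) σ ∉
      openPathEvent (lineProd G) (5 * Fintype.card V) := by
  classical
  rintro ⟨x, y, w, hw, hl⟩
  have h1 : w.support.toFinset ⊆
      Finset.Icc (3 * barrierCell σ x - 2) (3 * barrierCell σ x + 2) ×ˢ Finset.univ := by
    intro z hz
    rw [List.mem_toFinset] at hz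
    have h2 := barrierCell_bounds σ z
    rw [barrierCell_eq_of_walk w z hz] at h2
    simpa using h2
  have h2 := Finset.card_le_card h1
  rw [List.toFinset_card_of_nodup hw.support_nodup, SimpleGraph.Walk.length_support, hl,
    Finset.card_product, Int.card_Icc, Finset.card_univ] at h2
  have h3 : (3 * barrierCell σ x + 2 + 1 - (3 * barrierCell σ x - 2)).toNat = 5 := by omega
  rw [h3] at h2
  omega

lemma barrierProb_mem (x : ℤ × V) : barrierProb x ∈ Set.Icc (0 : ℝ) 1 := by
  have h1 : (1 : ℝ) ≤ √3 := Real.le_sqrt_of_sq_le (by norm_num)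
  have h2 : √3 ≤ 2 := Real.sqrt_le_iff.2 (by norm_num)
  unfold barrierProb
  split_ifs <;> constructor <;> linarith

/-- With `a = (3 - √3) / 2` and `b = √3 - 1`, the three critical edge types balance: `a² + (1 - a)²
= 1 - a * b = b² = 4 - 2 * √3`. The other types have probabilities `1`, `a` and `b`, all larger. -/
lemma le_coins_barrierRel {x y : ℤ × V} (hxy : x ≠ y)
    (h : y.1 = x.1 ∨ y.1 = x.1 + 1 ∧ x.2 = y.2) :
    4 - 2 * √3 ≤ (coins barrierProb).real {σ | barrierRel x y (σ x) (σ y)} := by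
  have := isProbabilityMeasure_coins (barrierProb_mem (V := V))
  have h0 : √3 * √3 = 3 := Real.mul_self_sqrt (by norm_num)
  have h1 : (5 / 3 : ℝ) ≤ √3 := Real.le_sqrt_of_sq_le (by norm_num)
  have h2 : √3 ≤ 2 := Real.sqrt_le_iff.2 (by norm_num)
  have h3 : x.1 % 3 = 0 ∨ x.1 % 3 = 1 ∨ x.1 % 3 = 2 := by omega
  rcases h with h | ⟨h, hv⟩
  · have hlt : ¬ (x.1 = x.1 + 1) := by omega
    rcases h3 with h3 | h3 | h3
    · have e : {σ : ℤ × V → Bool | barrierRel x y (σ x) (σ y)} = Set.univ := by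
        ext σ; simp [barrierRel, h, h3]
      rw [e, probReal_univ]
      linarith
    · have e : {σ : ℤ × V → Bool | barrierRel x y (σ x) (σ y)} = {σ | σ x = σ y} := by
        ext σ; simp [barrierRel, h, h3]
      rw [e, coins_real_eq barrierProb_mem hxy, barrierProb, barrierProb, h, if_pos h3]
      nlinarith
    · have e : {σ : ℤ × V → Bool | barrierRel x y (σ x) (σ y)} =
          {σ | σ x = true ∧ σ y = true} := by
        ext σ; simp [barrierRel, h, h3]
      rw [e, coins_real_pair barrierProb_mem hxy, coin_real_true (barrierProb_mem x).1,
        coin_real_true (barrierProb_mem y).1, barrierProb, barrierProb, h, if_neg (by omega)]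
      nlinarith
  · rcases h3 with h3 | h3 | h3
    · have e : {σ : ℤ × V → Bool | barrierRel x y (σ x) (σ y)} = {σ | σ y = true} := by
        ext σ; simp [barrierRel, h, h3, hv]
      rw [e, coins_real_true barrierProb_mem, barrierProb, if_pos (by omega)]
      linarith
    · have e : {σ : ℤ × V → Bool | barrierRel x y (σ x) (σ y)} =
          {σ | ¬ (σ x = true ∧ σ y = true)} := by
        ext σ; simp [barrierRel, h, h3, hv]
      rw [e, coins_real_not_and barrierProb_mem hxy, barrierProb, barrierProb, if_pos h3,
        if_neg (by omega)]
      nlinarith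
    · have e : {σ : ℤ × V → Bool | barrierRel x y (σ x) (σ y)} = {σ | σ x = true} := by
        ext σ; simp [barrierRel, h, h3, hv]
      rw [e, coins_real_true barrierProb_mem, barrierProb, if_neg (by omega)]
      linarith

theorem lt_of_mem_longPathProbs [Fintype V] {p : ℝ} (hp : p ∈ longPathProbs (lineProd G)) :
    4 - 2 * √3 < p := by
  by_contra! h
  have h1 : (coins barrierProb).map (vertexConfig barrierRel (lineProd G)) ∈
      modelsGE 1 (4 - 2 * √3) (lineProd G) := by
    refine vertexConfig_mem_modelsGE _ barrierProb_mem fun x y hxy => ?_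
    rcases lineProd_adj.1 hxy with ⟨h1 | h1, h2⟩ | ⟨-, h1⟩
    · exact Or.inl (le_coins_barrierRel hxy.ne (Or.inr ⟨h1, h2⟩))
    · exact Or.inr (le_coins_barrierRel hxy.ne' (Or.inr ⟨h1, h2.symm⟩))
    · exact Or.inl (le_coins_barrierRel hxy.ne (Or.inl h1.symm))
  have h2 := hp.2 _ (modelsGE_anti h h1) (5 * Fintype.card V)
  have : Countable V := Finite.to_countable
  rw [Measure.map_apply (measurable_vertexConfig _) (measurableSet_openPathEvent _),
    Set.preimage_eq_empty_iff.2] at h2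
  · simp at h2
  · rw [Set.disjoint_right]
    rintro _ ⟨σ, rfl⟩
    exact vertexConfig_notMem_openPathEvent σ

/-- Nonemptiness matters because the real infimum of the empty set is `0`. -/
theorem le_longPathsCritProb [Fintype V] (hne : (longPathProbs (lineProd G)).Nonempty) :
    4 - 2 * √3 ≤ longPathsCritProb (lineProd G) :=
  le_csInf hne fun _ hp => (lt_of_mem_longPathProbs hp).le

end Barrier

/-! ### Numerical thresholds and the limit -/

open SimpleGraph

lemma longPathProbs_lineProd_subset {V W : Type*} [Countable V] {G : SimpleGraph V}
    {H : SimpleGraph W} (φ : G →g H) (hφ : Function.Injective φ) :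
    longPathProbs (lineProd G) ⊆ longPathProbs (lineProd H) := by
  refine longPathProbs_subset (φ := ⟨Prod.map id φ, fun {x y} h => ?_⟩)
    (Function.injective_id.prodMap hφ)
  rw [lineProd_adj] at h ⊢
  exact h.imp (And.imp_right (congrArg φ)) (And.imp_left φ.map_adj)

/-- Already the ladder over a single edge suffices: `4 * (1 - p) ^ 2 ≤ p ^ 2` becomes an equality at
`p = 2/3`. -/
lemma two_thirds_mem_longPathProbs {n : ℕ} (hn : 2 ≤ n) :
    (2 / 3 : ℝ) ∈ longPathProbs (lineProd (pathGraph n)) := by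
  refine longPathProbs_lineProd_subset (pathGraph_two_embedding n hn).toHom
    (pathGraph_two_embedding n hn).injective ?_
  refine mem_longPathProbs_lineProd (f := 2 / 3) (by norm_num) (by norm_num) ?_
    fun μ hμ => le_measureReal_path_two_preconnected hμ
  rw [Fintype.card_fin]
  norm_num

lemma longPathProbs_path_subset_cycle (n : ℕ) :
    longPathProbs (lineProd (pathGraph n)) ⊆ longPathProbs (lineProd (cycleGraph n)) :=
  longPathProbs_lineProd_subset (Hom.ofLE pathGraph_le_cycleGraph) fun _ _ h => h

lemma mem_longPathProbs_cycle_three {r : ℝ} (hr : 1 / 3 < r) (hr' : r ≤ 1)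
    (h : 16 * (1 - r) ^ 3 ≤ (3 * r - 1) ^ 2) :
    r ∈ longPathProbs (lineProd (completeGraph (Fin 3))) := by
  rw [completeGraph, ← cycleGraph_three_eq_top]
  refine mem_longPathProbs_lineProd (f := (3 * r - 1) / 2) ⟨by linarith, hr'⟩ (by linarith) ?_
    fun μ hμ => ?_
  · rw [Fintype.card_fin]
    linarith
  · have := le_measureReal_cycle_preconnected (n := 0) hμ
    norm_num at this ⊢
    exact this

lemma mem_longPathProbs_cycle_four {r : ℝ} (hr : 1 / 2 < r) (hr' : r ≤ 1)
    (h : 4 * (1 - r) ^ 4 ≤ (2 * r - 1) ^ 2) :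
    r ∈ longPathProbs (lineProd (cycleGraph 4)) := by
  refine mem_longPathProbs_lineProd (f := 2 * r - 1) ⟨by linarith, hr'⟩ (by linarith) ?_
    fun μ hμ => ?_
  · rw [Fintype.card_fin]
    linarith
  · have := le_measureReal_cycle_preconnected (n := 1) hμ
    refine le_trans ?_ this
    norm_num
    linarith

lemma mem_longPathProbs_cycle_five {r : ℝ} (hr : 1 / 2 ≤ r) (hr' : r ≤ 1) (hr3 : 1 < 3 * r ^ 2)
    (h : 4 * (1 - r) ^ 5 ≤ (r * (3 * r ^ 2 - 1) / (3 * r - 1)) ^ 2) :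
    r ∈ longPathProbs (lineProd (cycleGraph 5)) := by
  refine mem_longPathProbs_lineProd (f := r * (3 * r ^ 2 - 1) / (3 * r - 1))
    ⟨by linarith, hr'⟩ ?_ ?_ fun μ hμ => le_measureReal_five_cycle_preconnected hr hr3.le hμ
  · exact div_pos (mul_pos (by linarith) (by linarith)) (by linarith)
  · rw [Fintype.card_fin]
    exact h

/-- Cardano's formula: with `u = c - 55 / c` the equation becomes `c ^ 6 + 502 * c ^ 3 - 55 ^ 3 =
0`, and `251 ^ 2 + 55 ^ 3 = 14 * 128 ^ 2`. -/
lemma exists_cubic_root :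
    ∃ u : ℝ, u = -(55 / (128 * √14 - 251) ^ ((1 : ℝ) / 3)) + (128 * √14 - 251) ^ ((1 : ℝ) / 3) ∧
      u ^ 3 + 165 * u + 502 = 0 := by
  have h14 : √14 ^ 2 = 14 := Real.sq_sqrt (by norm_num)
  have h3 : (3 : ℝ) ≤ √14 := Real.le_sqrt_of_sq_le (by norm_num)
  have hD : 0 < 128 * √14 - 251 := by linarith
  set c : ℝ := (128 * √14 - 251) ^ ((1 : ℝ) / 3) with hc
  have hc0 : 0 < c := Real.rpow_pos_of_pos hD _
  have hc3 : c ^ 3 = 128 * √14 - 251 := by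
    rw [hc, ← Real.rpow_natCast, ← Real.rpow_mul hD.le]
    norm_num
  refine ⟨_, rfl, ?_⟩
  have key : c ^ 3 * c ^ 3 + 502 * c ^ 3 - 55 ^ 3 = 0 := by
    rw [hc3]
    nlinarith
  field_simp
  linear_combination key

lemma five_cycle_quotient_le {x y : ℝ} (hx : 1 / 2 ≤ x) (hx3 : 1 ≤ 3 * x ^ 2) (hxy : x ≤ y)
    (hy : y ≤ 1) :
    x * (3 * x ^ 2 - 1) / (3 * x - 1) ≤ y * (3 * y ^ 2 - 1) / (3 * y - 1) := by
  rw [mul_div_assoc, mul_div_assoc]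
  refine mul_le_mul hxy ?_ (div_nonneg (by linarith) (by linarith)) (by linarith)
  rw [div_le_div_iff₀ (by linarith) (by linarith)]
  -- After cross-multiplication the difference of the two sides is `3 * (y - x)` times this
  -- expression.
  have h1 : 0 ≤ x * y + x * y + (1 - x) * (1 - y) := by
    have := mul_nonneg (by linarith : (0 : ℝ) ≤ x) (by linarith : (0 : ℝ) ≤ y)
    have := mul_nonneg (by linarith : (0 : ℝ) ≤ 1 - x) (by linarith : (0 : ℝ) ≤ 1 - y)
    linarith
  linarith [mul_nonneg (by linarith : (0 : ℝ) ≤ y - x) h1]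

/-- The function whose root is the threshold of the five-cycle. -/
noncomputable def fiveCycleFun (x : ℝ) : ℝ :=
  (x * (3 * x ^ 2 - 1) / (3 * x - 1)) ^ 2 - 4 * (1 - x) ^ 5

lemma fiveCycleFun_lt {x y : ℝ} (hx : 1 / 2 ≤ x) (hx3 : 1 ≤ 3 * x ^ 2) (hxy : x < y)
    (hy : y ≤ 1) : fiveCycleFun x < fiveCycleFun y := by
  have h1 := pow_le_pow_left₀ (div_nonneg (mul_nonneg (by linarith) (by linarith)) (by linarith))
    (five_cycle_quotient_le hx hx3 hxy.le hy) 2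
  have h2 : (1 - y) ^ 5 < (1 - x) ^ 5 :=
    pow_lt_pow_left₀ (by linarith) (by linarith) (by norm_num)
  unfold fiveCycleFun
  linarith

lemma exists_fiveCycleFun_eq_zero :
    ∃ r : ℝ, 0.63895 ≤ r ∧ r < 0.63896 ∧ fiveCycleFun r = 0 := by
  have hcont : ContinuousOn fiveCycleFun (Set.Icc 0.63895 0.63896) := by
    unfold fiveCycleFun
    refine ContinuousOn.sub (ContinuousOn.pow (ContinuousOn.div (by fun_prop) (by fun_prop) ?_) 2)
      (by fun_prop)
    intro x hx
    have := hx.1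
    norm_num at this
    linarith
  have h1 : fiveCycleFun 0.63895 ≤ 0 := by
    norm_num [fiveCycleFun]
  have h2 : 0 < fiveCycleFun 0.63896 := by
    norm_num [fiveCycleFun]
  obtain ⟨r, hr, hr0⟩ := intermediate_value_Icc (by norm_num) hcont ⟨h1, h2.le⟩
  refine ⟨r, hr.1, lt_of_le_of_ne hr.2 ?_, hr0⟩
  rintro rfl
  exact h2.ne' hr0

lemma completeGraph_subset {m n : ℕ} (h : m ≤ n) :
    longPathProbs (lineProd (completeGraph (Fin m))) ⊆
      longPathProbs (lineProd (completeGraph (Fin n))) :=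
  longPathProbs_lineProd_subset
    ⟨Fin.castLE h, fun hab hab' => hab (Fin.castLE_injective h hab')⟩
    (Fin.castLE_injective h)

/-- The substitution `r = (13 + u) / 16` removes the quadratic term of the threshold equation. The
cubic in `u` is increasing, so its root is located by signs at the points corresponding to `0.63154`
and `0.63155`. -/
lemma cubic_threshold {u r : ℝ} (hu : u ^ 3 + 165 * u + 502 = 0) (hr : r = 1 / 16 * (13 + u)) :
    0.63154 ≤ r ∧ r < 0.63155 ∧ 16 * (1 - r) ^ 3 = (3 * r - 1) ^ 2 := by
  have h1 : (-2.89536 : ℝ) ≤ u := by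
    by_contra! h
    nlinarith [sq_nonneg (u - 2.89536), sq_nonneg (u + 2.89536), sq_nonneg u]
  have h2 : u < (-2.8952 : ℝ) := by
    by_contra! h
    nlinarith [sq_nonneg (u - 2.8952), sq_nonneg (u + 2.8952), sq_nonneg u]
  refine ⟨?_, ?_, ?_⟩
  · rw [hr]; norm_num at h1 ⊢; linarith
  · rw [hr]; norm_num at h2 ⊢; linarith
  · rw [hr]
    linear_combination (-1 / 256) * hu

lemma nonempty_complete {n : ℕ} (hn : 3 ≤ n) :
    (longPathProbs (lineProd (completeGraph (Fin n)))).Nonempty :=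
  ⟨2 / 3, completeGraph_subset hn (mem_longPathProbs_cycle_three (by norm_num) (by norm_num)
    (by norm_num))⟩

lemma exists_tendsto_complete : ∃ L : ℝ,
    Filter.Tendsto (fun n : ℕ => longPathsCritProb (lineProd (completeGraph (Fin n))))
      Filter.atTop (nhds L) ∧ 4 - 2 * √3 ≤ L ∧ L ≤ 5 / 9 := by
  -- The shift restricts to sizes at least 3, where the set of admissible probabilities is known to
  -- be nonempty, so that the infima are monotone.
  set a : ℕ → ℝ := fun n => longPathsCritProb (lineProd (completeGraph (Fin (n + 3)))) with ha
  have hlow : ∀ n, 4 - 2 * √3 ≤ a n := fun n => le_longPathsCritProb (nonempty_complete (by omega))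
  have hanti : Antitone a := fun m n h =>
    csInf_le_csInf (bddBelow_longPathProbs _) (nonempty_complete (by omega))
      (completeGraph_subset (by omega))
  have hbdd : BddBelow (Set.range a) := ⟨_, by rintro _ ⟨n, rfl⟩; exact hlow n⟩
  refine ⟨⨅ n, a n, ?_, le_ciInf hlow, ?_⟩
  · exact (Filter.tendsto_add_atTop_iff_nat 3).1 (tendsto_atTop_ciInf hanti hbdd)
  · refine le_of_forall_pos_le_add fun δ hδ => ?_
    -- The cap `4/9` keeps `5/9 + ε` at most `1`.
    set ε : ℝ := min δ (4 / 9) with hε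
    have hε0 : 0 < ε := lt_min hδ (by norm_num)
    obtain ⟨n, hn⟩ := exists_nat_ge (512 / ε ^ 2)
    refine (ciInf_le hbdd n).trans ((longPathsCritProb_le (p := 5 / 9 + ε) ?_).trans
      (add_le_add le_rfl (min_le_left _ _)))
    refine mem_longPathProbs_complete hε0 (by linarith [min_le_right δ (4 / 9)]) ?_
    rw [Fintype.card_fin]
    rw [div_le_iff₀ (by positivity)] at hn
    push_cast
    nlinarith [sq_nonneg ε]

end OneIndep

theorem theorem4 :
    ((0.535898 : ℝ) ≤ 4 - 2 * √3 ∧ (4 - 2 * √3 : ℝ) < 0.535899 ∧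
      ∀ n : ℕ, 3 ≤ n →
        4 - 2 * √3 ≤ OneIndep.longPathsCritProb
            (OneIndep.lineProd (SimpleGraph.cycleGraph n)) ∧
        OneIndep.longPathsCritProb (OneIndep.lineProd (SimpleGraph.cycleGraph n)) ≤
          OneIndep.longPathsCritProb (OneIndep.lineProd (SimpleGraph.pathGraph n)) ∧
        OneIndep.longPathsCritProb (OneIndep.lineProd (SimpleGraph.pathGraph n)) ≤ 2 / 3) ∧
    (∃ r : ℝ,
      r = 1 / 16 * (13 - 55 / (128 * √14 - 251) ^ ((1 : ℝ) / 3)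
            + (128 * √14 - 251) ^ ((1 : ℝ) / 3)) ∧
      0.63154 ≤ r ∧ r < 0.63155 ∧
      OneIndep.longPathsCritProb (OneIndep.lineProd (SimpleGraph.completeGraph (Fin 3))) ≤ r) ∧
    ((0.63397 : ℝ) ≤ (3 - √3) / 2 ∧ ((3 - √3) / 2 : ℝ) < 0.63398 ∧
      OneIndep.longPathsCritProb (OneIndep.lineProd (SimpleGraph.cycleGraph 4)) ≤
        (3 - √3) / 2) ∧
    (∃ r : ℝ,
      (∀ x ∈ Set.Icc (√3 / 3) 1,
        (x * (3 * x ^ 2 - 1) / (3 * x - 1)) ^ 2 = 4 * (1 - x) ^ 5 ↔ x = r) ∧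
      0.63895 ≤ r ∧ r < 0.63896 ∧
      OneIndep.longPathsCritProb (OneIndep.lineProd (SimpleGraph.cycleGraph 5)) ≤ r) ∧
    (∃ L : ℝ,
      Filter.Tendsto
        (fun n : ℕ => OneIndep.longPathsCritProb
          (OneIndep.lineProd (SimpleGraph.completeGraph (Fin n))))
        Filter.atTop (nhds L) ∧
      4 - 2 * √3 ≤ L ∧ L ≤ 5 / 9) := by

  have h0 : √3 ^ 2 = 3 := Real.sq_sqrt (by norm_num)
  have h1 : (1.7320505 : ℝ) < √3 := Real.lt_sqrt_of_sq_lt (by norm_num)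
  have h2 : √3 < 1.732051 := (Real.sqrt_lt' (by norm_num)).2 (by norm_num)
  norm_num at h1 h2
  refine ⟨⟨by norm_num; linarith, by norm_num; linarith, fun n hn => ⟨?_, ?_, ?_⟩⟩, ?_,
    ⟨by norm_num; linarith, by norm_num; linarith, ?_⟩, ?_, OneIndep.exists_tendsto_complete⟩
  · exact OneIndep.le_longPathsCritProb
      ⟨_, OneIndep.longPathProbs_path_subset_cycle n
        (OneIndep.two_thirds_mem_longPathProbs (by omega))⟩
  · exact csInf_le_csInf (OneIndep.bddBelow_longPathProbs _)
      ⟨_, OneIndep.two_thirds_mem_longPathProbs (by omega)⟩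
      (OneIndep.longPathProbs_path_subset_cycle n)
  · exact OneIndep.longPathsCritProb_le (OneIndep.two_thirds_mem_longPathProbs (by omega))
  · obtain ⟨u, hu, hu0⟩ := OneIndep.exists_cubic_root
    obtain ⟨g1, g2, g3⟩ := OneIndep.cubic_threshold hu0 rfl
    refine ⟨1 / 16 * (13 + u), by rw [hu]; ring, g1, g2, ?_⟩
    norm_num at g1 g2
    exact OneIndep.longPathsCritProb_le
      (OneIndep.mem_longPathProbs_cycle_three (by linarith) (by linarith) g3.le)
  · refine OneIndep.longPathsCritProb_le
      (OneIndep.mem_longPathProbs_cycle_four (by linarith) (by linarith) (le_of_eq ?_))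
    -- At `r = (3 - √3) / 2` the condition `2 * (1 - r) ^ 2 ≤ 2 * r - 1` is an equality.
    linear_combination (√3 ^ 2 / 4 - √3 + 5 / 4) * h0
  · obtain ⟨r, g1, g2, g3⟩ := OneIndep.exists_fiveCycleFun_eq_zero
    have g4 : (1 : ℝ) / 2 ≤ r ∧ r ≤ 1 := by norm_num at g1 g2; constructor <;> linarith
    have g5 : 1 < 3 * r ^ 2 := by norm_num at g1; nlinarith
    have hroot : ∀ x : ℝ, (x * (3 * x ^ 2 - 1) / (3 * x - 1)) ^ 2 = 4 * (1 - x) ^ 5 ↔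
        OneIndep.fiveCycleFun x = 0 := fun x => by rw [OneIndep.fiveCycleFun, sub_eq_zero]
    refine ⟨r, fun x hx => ?_, g1, g2, OneIndep.longPathsCritProb_le
      (OneIndep.mem_longPathProbs_cycle_five g4.1 g4.2 g5 ((hroot r).2 g3).ge)⟩
    rw [hroot]
    -- The left endpoint `√3 / 3` is where `3 * x ^ 2 - 1` becomes nonnegative; from there on
    -- `fiveCycleFun` is strictly increasing, so the root is unique.
    have g6 : 1 ≤ 3 * x ^ 2 := by nlinarith [hx.1]
    constructor
    · intro hx0
      rcases lt_trichotomy x r with h | h | h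
      · have := OneIndep.fiveCycleFun_lt (by linarith [hx.1]) g6 h g4.2
        linarith
      · exact h
      · have := OneIndep.fiveCycleFun_lt g4.1 g5.le h hx.2
        linarith
    · rintro rfl
      exact g3
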